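/- Let $\Theta\subset\mathbb{R}^d$ be compact and let $p(\cdot\,|\,\mathbf d)$ be a continuous probability density on $\Theta$ with $0<m\le p(\theta|\mathbf d)\le M<\infty$ on $\Theta$; write $f=\log p(\cdot\,|\,\mathbf d)$. Let $L$ be a Markov kernel on $\mathbb{R}^d$ such that, for $x\in\Theta$, $L(x,\cdot)$ has a density $\ell(x,\cdot)$ with respect to Lebesgue measure, where $\ell$ is measurable, $\ell(x,y)=\ell(y,x)$ and $0<m'\le \ell(x,y)\le M'<\infty$ for all $x,y\in\Theta$. Put $N=(d+1)(d+2)/2$ and fix $0<\beta<1$, $\lambda>0$, thresholds $\gamma_t\in\mathbb{R}$, a starting point $X_0=x_0\in\Theta$ and a finite set $\mathcal S_0\subset\Theta$ with at least $N$ points. *Local approximation.* For a finite set $\mathcal S\subset\Theta$ let $\mathcal B(\theta,\mathcal S)$ be the $N$ points of $\mathcal S$ nearest to $\theta$ (ties broken arbitrarily). The approximation $\tilde f_{\mathcal S}(\theta)$ is $f(\theta)$ if $\theta\in\mathcal S$, and otherwise the value at $\theta$ of the quadratic polynomial fitted by least squares to $f$ on $\mathcal B(\theta,\mathcal S)$ (the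 interpolating quadratic, whenever it exists and is unique); $\tilde f^{\sim j}_{\mathcal S}(\theta)$ is the value at $\theta$ of a least squares quadratic fit with the sample $j\in\mathcal B(\theta,\mathcal S)$ left out. Where the fit is not unique, any choice is allowed. The set $\mathcal B(\theta,\mathcal S)$ is $\lambda$-poised if every function on it is interpolated by exactly one polynomial of degree at most $2$ and its Lagrange polynomials are bounded by $\lambda$ in absolute value on the smallest closed ball around $\theta$ containing it. For $\theta^-,\theta^+\in\Theta$ put $\zeta=\exp(\tilde f_{\mathcal S}(\theta^+)-\tilde f_{\mathcal S}(\theta^-))$, let $\zeta^{\pm,\sim j}$ be the same ratio with $\tilde f_{\mathcal S}(\theta^\pm)$ replaced by $\tilde f^{\sim j}_{\mathcal S}(\theta^\pm)$, and $$\epsilon^{\pm}=\max_{j\in\mathcal B(\theta^\pm,\mathcal S)}\Big(\big|\min(1,\zeta)-\min(1,\zeta^{\pm,\sim j})\big|+\big|\min(1,\tfrac1\zeta)-\min(1,\tfrac1{\zeta^{\pm,\sim j}})\big|\Big).$$ *Step $t$ of the chain* from $(X_t,\mathcal S_t)=(\theta^-,\mathcal S)$: draw $\theta^+\sim L(\theta^-,\cdot)$.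 If $\theta^+\notin\Theta$, put $(X_{t+1},\mathcal S_{t+1})=(\theta^-,\mathcal S)$. Otherwise repeat the following pass, with fresh independent randomness: 1. with probability $\beta$, add $\theta^+$ or $\theta^-$ to $\mathcal S$, each with probability $\tfrac12$, and repeat; 2. else, if $\theta^+\notin\mathcal S$ and either ($\epsilon^+\ge\epsilon^-$ and $\epsilon^+\ge\gamma_t$) or $\mathcal B(\theta^+,\mathcal S)$ is not $\lambda$-poised, add $\theta^+$ to $\mathcal S$ and repeat; 3. else, if $\theta^-\notin\mathcal S$ and either ($\epsilon^->\epsilon^+$ and $\epsilon^-\ge\gamma_t$) or $\mathcal B(\theta^-,\mathcal S)$ is not $\lambda$-poised, add $\theta^-$ to $\mathcal S$ and repeat; 4. else draw an independent uniform $u\in[0,1]$, put $X_{t+1}=\theta^+$ if $u<\min(1,\zeta)$ and $X_{t+1}=\theta^-$ otherwise, put $\mathcal S_{t+1}=\mathcal S$, and end the step. Then every version of this process satisfies $$\lim_{t\to\infty}\big\|\mathcal L(X_t)-p(\cdot\,|\,\mathbf d)\big\|_{\mathrm{TV}}=0 .$$ -/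

import Mathlib

open MeasureTheory ProbabilityTheory Filter Topology
open scoped unitInterval NNReal ENNReal

noncomputable section

namespace LocalApproxMH

/-- `ℝ^d` with the Euclidean norm. -/
abbrev Pt (d : ℕ) : Type := EuclideanSpace ℝ (Fin d)

/-- The number of points that determines a quadratic polynomial in `d` variables. -/
def Ndef (d : ℕ) : ℕ := (d + 1) * (d + 2) / 2

/-- The value of a polynomial at a point of `ℝ^d`. -/
def evalAt {d : ℕ} (q : MvPolynomial (Fin d) ℝ) (z : Pt d) : ℝ :=
  MvPolynomial.eval (fun i => z i) q

/-- `q` is a polynomial of degree at most two that is a least squares fit to the samples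
`(y, f y)`, `y ∈ Y`. If the points of `Y` are poised for quadratic interpolation, this is exactly
the interpolating quadratic. -/
def IsQuadFit {d : ℕ} (f : Pt d → ℝ) (Y : Finset (Pt d)) (q : MvPolynomial (Fin d) ℝ) : Prop :=
  q.totalDegree ≤ 2 ∧
    ∀ q' : MvPolynomial (Fin d) ℝ, q'.totalDegree ≤ 2 →
      ∑ y ∈ Y, (evalAt q y - f y) ^ 2 ≤ ∑ y ∈ Y, (evalAt q' y - f y) ^ 2

/-- `Y` is poised for quadratic interpolation: all data on `Y` are interpolated by exactly one
polynomial of degree at most two. -/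
def IsPoised {d : ℕ} (Y : Finset (Pt d)) : Prop :=
  ∀ g : Pt d → ℝ, ∃! q : MvPolynomial (Fin d) ℝ,
    q.totalDegree ≤ 2 ∧ ∀ y ∈ Y, evalAt q y = g y

/-- `q` is the Lagrange polynomial of the point `y` with respect to `Y`. -/
def IsLagrange {d : ℕ} (Y : Finset (Pt d)) (y : Pt d) (q : MvPolynomial (Fin d) ℝ) : Prop :=
  q.totalDegree ≤ 2 ∧ evalAt q y = 1 ∧ ∀ y' ∈ Y, y' ≠ y → evalAt q y' = 0

/-- The radius of the smallest closed ball around `θ` that contains `Y`. -/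
def radius {d : ℕ} (θ : Pt d) (Y : Finset (Pt d)) : ℝ≥0 := Y.sup fun y => nndist y θ

/-- `Y` is `lam`-poised in the smallest closed ball around `θ` that contains it: it is poised and
its Lagrange polynomials are bounded by `lam` on that ball. -/
def IsLamPoised {d : ℕ} (lam : ℝ) (θ : Pt d) (Y : Finset (Pt d)) : Prop :=
  IsPoised Y ∧ ∀ y ∈ Y, ∀ q : MvPolynomial (Fin d) ℝ, IsLagrange Y y q →
    ∀ z ∈ Metric.closedBall θ (radius θ Y : ℝ), |evalAt q z| ≤ lam

open Classical in
/-- A version of the local approximation subroutine for the function `f`. `nbr θ S` are the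
`Ndef d` points of `S` nearest to `θ`, ties in the distance being broken in any way, and
`poly θ S j` is the quadratic fit to the samples at these points, without the sample `j` if
`j` is not `none`. Where a fit is not unique (non-poised points, or one sample left out), any of
the least squares solutions may be used. -/
structure LocApprox {d : ℕ} (f : Pt d → ℝ) where
  nbr : Pt d → Finset (Pt d) → Finset (Pt d)
  nbr_subset : ∀ θ S, nbr θ S ⊆ S
  nbr_card : ∀ θ S, Ndef d ≤ S.card → (nbr θ S).card = Ndef d
  nbr_nearest : ∀ θ S, ∀ y ∈ nbr θ S, ∀ z ∈ S, z ∉ nbr θ S → dist y θ ≤ dist z θ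
  poly : Pt d → Finset (Pt d) → Option (Pt d) → MvPolynomial (Fin d) ℝ
  poly_none : ∀ θ S, IsQuadFit f (nbr θ S) (poly θ S none)
  poly_some : ∀ θ S j, IsQuadFit f ((nbr θ S).erase j) (poly θ S (some j))

section Algorithm

variable {d : ℕ} {f : Pt d → ℝ} (A : LocApprox f)

open Classical in
/-- The nominal approximation of `f θ` based on the sample set `S`. At a sampled point this is the
sampled value, which every interpolant reproduces. -/
def nominal (θ : Pt d) (S : Finset (Pt d)) : ℝ :=
  if θ ∈ S then f θ else evalAt (A.poly θ S none) θ

/-- The approximation of `f θ` with the sample `j` left out. -/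
def leaveOut (θ : Pt d) (S : Finset (Pt d)) (j : Pt d) : ℝ :=
  evalAt (A.poly θ S (some j)) θ

/-- The approximate density ratio `ζ` between the proposal `y` and the current point `x`
(`f` is the logarithm of the target density). -/
def zeta (x y : Pt d) (S : Finset (Pt d)) : ℝ :=
  Real.exp (nominal A y S) / Real.exp (nominal A x S)

/-- The ratio with sample `j` left out in the approximation at the proposal `y`. -/
def zetaPlus (x y : Pt d) (S : Finset (Pt d)) (j : Pt d) : ℝ :=
  Real.exp (leaveOut A y S j) / Real.exp (nominal A x S)

/-- The ratio with sample `j` left out in the approximation at the current point `x`. -/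
def zetaMinus (x y : Pt d) (S : Finset (Pt d)) (j : Pt d) : ℝ :=
  Real.exp (nominal A y S) / Real.exp (leaveOut A x S j)

/-- The difference of the acceptance probabilities, forward and reverse, for two ratios. -/
def accDiff (z z' : ℝ) : ℝ :=
  |min 1 z - min 1 z'| + |min 1 (1 / z) - min 1 (1 / z')|

/-- The cross-validation error indicator at the proposal `y`. -/
def epsPlus (x y : Pt d) (S : Finset (Pt d)) : ℝ :=
  ⨆ j : {j // j ∈ A.nbr y S}, accDiff (zeta A x y S) (zetaPlus A x y S j)

/-- The cross-validation error indicator at the current point `x`. -/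
def epsMinus (x y : Pt d) (S : Finset (Pt d)) : ℝ :=
  ⨆ j : {j // j ∈ A.nbr x S}, accDiff (zeta A x y S) (zetaMinus A x y S j)

open Classical in
/-- The refinement decision in one pass of the loop, at current point `x`, proposal `y` and sample
set `S`: the point at which to refine, or `none`. With probability `β` (decided by the uniform
draw `u.1`) one refines at one of `x` and `y`, chosen with probability one half each (by `u.2`).
Otherwise cross-validation and `lam`-poisedness are checked. A point that has already been sampled
cannot be refined any further, so these checks only concern points outside `S`. -/
def refineAt (β γ lam : ℝ) (x y : Pt d) (u : I × I) (S : Finset (Pt d)) : Option (Pt d) :=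
  if (u.1 : ℝ) < β then
    if (u.2 : ℝ) < 1 / 2 then some y else some x
  else if y ∉ S ∧ ((epsMinus A x y S ≤ epsPlus A x y S ∧ γ ≤ epsPlus A x y S) ∨
      ¬ IsLamPoised lam y (A.nbr y S)) then some y
  else if x ∉ S ∧ ((epsPlus A x y S < epsMinus A x y S ∧ γ ≤ epsMinus A x y S) ∨
      ¬ IsLamPoised lam x (A.nbr x S)) then some x
  else none

open Classical in
/-- The sample set after `k` passes of the refinement loop; refining at `θ` means adding `θ`. -/
def refined (β γ lam : ℝ) (x y : Pt d) (u : ℕ → I × I) (S : Finset (Pt d)) : ℕ → Finset (Pt d)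
  | 0 => S
  | k + 1 =>
    match refineAt A β γ lam x y (u k) (refined β γ lam x y u S k) with
    | none => refined β γ lam x y u S k
    | some θ => insert θ (refined β γ lam x y u S k)

/-- The random draws of one step besides the proposal: a pair of uniform variables for each
pass of the refinement loop, and a uniform variable for the final accept/reject decision. -/
abbrev Draws : Type := (ℕ → I × I) × I

/-- All draws are independent and uniform on `[0,1]`. -/
def drawLaw : Measure Draws :=
  (Measure.infinitePi fun _ : ℕ => (volume : Measure I).prod (volume : Measure I)).prod
    (volume : Measure I)

open Classical in
/-- One step of the algorithm on the parameter space `Θ`: from the state `(x, S)`, with proposal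
`y` and random draws `u`, it produces the state `(x', S')`. A proposal outside `Θ` (where the
target density vanishes) is rejected. Otherwise the refinement loop runs until the first pass
without refinement, and then the proposal is accepted with probability `min 1 ζ`. -/
def Step (Θ : Set (Pt d)) (β γ lam : ℝ) (x : Pt d) (S : Finset (Pt d)) (y : Pt d) (u : Draws)
    (x' : Pt d) (S' : Finset (Pt d)) : Prop :=
  (y ∉ Θ ∧ x' = x ∧ S' = S) ∨
  (y ∈ Θ ∧ ∃ k : ℕ,
    (∀ i < k, refineAt A β γ lam x y (u.1 i) (refined A β γ lam x y u.1 S i) ≠ none) ∧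
    refineAt A β γ lam x y (u.1 k) (refined A β γ lam x y u.1 S k) = none ∧
    S' = refined A β γ lam x y u.1 S k ∧
    x' = if (u.2 : ℝ) < min 1 (zeta A x y S') then y else x)

/-- The processes `X` (states) and `S` (sample sets) are a version of the chain produced by the
algorithm with proposal kernel `L`, started at `x₀` with sample set `S₀`. `Y t` is the proposal and
`U t` are the other random draws of step `t`. Given the past `ℱ t`, the proposal has law
`L (X t) ·`, and the other draws are uniform and independent of the past and of the proposal. -/
structure IsChain {Ω : Type*} {mΩ : MeasurableSpace Ω} (P : Measure Ω) (ℱ : Filtration ℕ mΩ)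
    (Θ : Set (Pt d)) (L : Kernel (Pt d) (Pt d)) (β : ℝ) (γ : ℕ → ℝ) (lam : ℝ)
    (x₀ : Pt d) (S₀ : Finset (Pt d))
    (X : ℕ → Ω → Pt d) (S : ℕ → Ω → Finset (Pt d))
    (Y : ℕ → Ω → Pt d) (U : ℕ → Ω → Draws) : Prop where
  measurable_X : ∀ t, Measurable[ℱ t] (X t)
  measurable_Y : ∀ t, Measurable[ℱ (t + 1)] (Y t)
  measurable_U : ∀ t, Measurable[ℱ (t + 1)] (U t)
  start_X : ∀ ω, X 0 ω = x₀
  start_S : ∀ ω, S 0 ω = S₀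
  draw : ∀ t (F : Set Ω), MeasurableSet[ℱ t] F →
    ∀ B : Set (Pt d), MeasurableSet B → ∀ C : Set Draws, MeasurableSet C →
      P (F ∩ (Y t ⁻¹' B ∩ U t ⁻¹' C)) = (∫⁻ ω in F, L (X t ω) B ∂P) * drawLaw C
  step : ∀ t, ∀ᵐ ω ∂P,
    Step A Θ β (γ t) lam (X t ω) (S t ω) (Y t ω) (U t ω) (X (t + 1) ω) (S (t + 1) ω)

end Algorithm

/-- The probability measure on `ℝ^d` with density `p` on `Θ` (and `0` outside `Θ`). -/
def targetMeasure {d : ℕ} (Θ : Set (Pt d)) (p : Pt d → ℝ) : Measure (Pt d) :=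
  (volume.restrict Θ).withDensity fun θ => ENNReal.ofReal (p θ)

/-- The total variation distance of two finite measures. -/
def tvDist {α : Type*} [MeasurableSpace α] (μ ν : Measure α) : ℝ :=
  ⨆ B : {B : Set α // MeasurableSet B}, |μ.real B - ν.real B|

end LocalApproxMH

end

noncomputable section

namespace LocalApproxMH

/-! The chain is compared, one step at a time, with the exact Metropolis-Hastings step `idealStep`
driven by the same proposal and the same uniform draw.

The exact kernel is reversible with respect to the target, and its jump density on `Θ` is at least
`δ` times the target density. Hence one exact step contracts the total variation distance to the
target by `1 - δ` (`abs_integral_jumpProb_sub_le`). So the distances satisfy `a (t+1) ≤ (1 - δ) * a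
t + e t`, where `e t` is the probability that step `t` differs from the exact step, and it suffices
that `e t → 0` (`tendsto_zero_of_contraction`).

For `e t → 0` (`tendsto_measure_ne_idealStep`), the forced random refinements eventually put samples
into every set of a finite net, so all relevant points have `N` samples within distance `r`. A pass
can end the loop only if the fits at unsampled points are `lam`-poised, and then each approximation
error is at most `N * lam` times the oscillation of `log p` at scale `r` (`abs_nominal_sub_le`).
Uniform continuity makes this small; no smoothness of `p` is needed. The decisions can then differ
only if the uniform draw falls into a short interval around the exact acceptance probability.

Cross-validation can only cause extra refinements, which never hurt. Termination of the refinement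
loop is part of `Step`. -/

theorem abs_min_one_exp_sub_le (a b : ℝ) :
    |min 1 (Real.exp a) - min 1 (Real.exp b)| ≤ |a - b| := by
  have key : ∀ a b : ℝ, a ≤ b → |min 1 (Real.exp a) - min 1 (Real.exp b)| ≤ |a - b| := by
    intro a b hab
    have h1 : min 1 (Real.exp a) ≤ min 1 (Real.exp b) := by gcongr
    rw [abs_of_nonpos (by linarith), abs_of_nonpos (by linarith)]
    rcases le_total 0 a with ha | ha
    · rw [min_eq_left (Real.one_le_exp ha), min_eq_left (Real.one_le_exp (ha.trans hab))]
      linarith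
    · rw [min_eq_right (Real.exp_le_one_iff.2 ha)]
      rcases le_total 0 b with hb | hb
      · rw [min_eq_left (Real.one_le_exp hb)]
        linarith [Real.add_one_le_exp a]
      · rw [min_eq_right (Real.exp_le_one_iff.2 hb)]
        have h2 : Real.exp a = Real.exp b * Real.exp (a - b) := by rw [← Real.exp_add]; ring_nf
        -- Here `exp b - exp a = exp b * (1 - exp (a - b)) ≤ exp b * (b - a) ≤ b - a`, since `exp b
        -- ≤ 1`.
        nlinarith [Real.add_one_le_exp (a - b), Real.exp_pos b, Real.exp_le_one_iff.2 hb]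
  rcases le_total a b with h | h
  · exact key a b h
  · rw [abs_sub_comm, abs_sub_comm a]
    exact key b a h

/-! ### Quadratic fits on poised sets -/

section Fit

variable {d : ℕ} {f : Pt d → ℝ}

/-- Poisedness provides an interpolant with zero residual, so the least squares minimum is zero and
every residual of a minimiser vanishes. -/
theorem IsQuadFit.interpolates {Y : Finset (Pt d)} {q : MvPolynomial (Fin d) ℝ}
    (hq : IsQuadFit f Y q) (hY : IsPoised Y) : ∀ y ∈ Y, evalAt q y = f y := by
  obtain ⟨q', ⟨hq'd, hq'⟩, -⟩ := hY f
  have h := hq.2 q' hq'd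
  rw [Finset.sum_eq_zero (s := Y) (f := fun y => (evalAt q' y - f y) ^ 2)
    (fun y hy => by rw [hq' y hy]; ring)] at h
  have h0 := (Finset.sum_eq_zero_iff_of_nonneg (fun y _ => sq_nonneg _)).1
    (le_antisymm h (Finset.sum_nonneg fun y _ => sq_nonneg _))
  intro y hy
  have := pow_eq_zero_iff (two_ne_zero) |>.1 (h0 y hy)
  linarith

theorem evalAt_sum {ι : Type*} (s : Finset ι) (c : ι → ℝ) (q : ι → MvPolynomial (Fin d) ℝ)
    (z : Pt d) :
    evalAt (∑ i ∈ s, MvPolynomial.C (c i) * q i) z = ∑ i ∈ s, c i * evalAt (q i) z := by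
  simp [evalAt]

theorem totalDegree_sum_C_mul_le {ι : Type*} (s : Finset ι) (c : ι → ℝ)
    (q : ι → MvPolynomial (Fin d) ℝ) (hq : ∀ i ∈ s, (q i).totalDegree ≤ 2) :
    (∑ i ∈ s, MvPolynomial.C (c i) * q i).totalDegree ≤ 2 := by
  refine (MvPolynomial.totalDegree_finsetSum _ _).trans (Finset.sup_le fun i hi => ?_)
  refine (MvPolynomial.totalDegree_mul _ _).trans ?_
  simpa using hq i hi

/-- Local quadratic interpolation on a `lam`-poised set reproduces a constant up to the
oscillation of the data. -/
theorem IsLamPoised.abs_evalAt_sub_le {lam : ℝ} {θ : Pt d} {Y : Finset (Pt d)}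
    (hY : IsLamPoised lam θ Y) {q : MvPolynomial (Fin d) ℝ} (hq : IsQuadFit f Y q)
    {c w : ℝ} (hw0 : 0 ≤ w) (hw : ∀ y ∈ Y, |f y - c| ≤ w) :
    |evalAt q θ - c| ≤ Y.card * (w * lam) := by
  classical
  have hL : ∀ y : Pt d, ∃ q : MvPolynomial (Fin d) ℝ, y ∈ Y → IsLagrange Y y q := by
    intro y
    obtain ⟨q, ⟨h1, h2⟩, -⟩ := hY.1 (fun z => if z = y then 1 else 0)
    exact ⟨q, fun hy => ⟨h1, by simp [h2 y hy], fun z hz hzy => by simp [h2 z hz, hzy]⟩⟩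
  choose ℓ hℓ using hL
  have hval : ∀ g : Pt d → ℝ, ∀ y ∈ Y,
      evalAt (∑ i ∈ Y, MvPolynomial.C (g i) * ℓ i) y = g y := by
    intro g y hy
    rw [evalAt_sum, Finset.sum_eq_single y]
    · rw [(hℓ y hy).2.1, mul_one]
    · intro z hz hzy
      rw [(hℓ z hz).2.2 y hy hzy.symm, mul_zero]
    · exact fun h => (h hy).elim
  have hdeg : ∀ g : Pt d → ℝ, (∑ i ∈ Y, MvPolynomial.C (g i) * ℓ i).totalDegree ≤ 2 :=
    fun g => totalDegree_sum_C_mul_le _ _ _ fun i hi => (hℓ i hi).1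
  -- Uniqueness of interpolation gives the Lagrange expansion both of the fit and of the constant
  -- `c`; subtracting them leaves only the deviations `f i - c`.
  have e1 : q = ∑ i ∈ Y, MvPolynomial.C (f i) * ℓ i :=
    (hY.1 f).unique ⟨hq.1, hq.interpolates hY.1⟩ ⟨hdeg f, hval f⟩
  have e2 : MvPolynomial.C c = ∑ i ∈ Y, MvPolynomial.C c * ℓ i :=
    (hY.1 fun _ => c).unique ⟨by simp, fun y _ => by simp [evalAt]⟩ ⟨hdeg _, hval _⟩
  have e3 : evalAt q θ - c = ∑ i ∈ Y, (f i - c) * evalAt (ℓ i) θ := by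
    have : c = ∑ i ∈ Y, c * evalAt (ℓ i) θ := by
      rw [← evalAt_sum Y (fun _ => c), ← e2]; simp [evalAt]
    conv_lhs => rw [e1, evalAt_sum, this, ← Finset.sum_sub_distrib]
    exact Finset.sum_congr rfl fun i _ => by ring
  rw [e3]
  refine (Finset.abs_sum_le_sum_abs _ _).trans ?_
  rw [← nsmul_eq_mul]
  refine Finset.sum_le_card_nsmul _ _ _ fun i hi => ?_
  rw [abs_mul]
  exact mul_le_mul (hw i hi) (hY.2 i hi _ (hℓ i hi) θ (Metric.mem_closedBall_self (by positivity)))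
    (abs_nonneg _) hw0

end Fit

/-! ### Deterministic properties of one step -/

section Deterministic

variable {d : ℕ} {f : Pt d → ℝ} (A : LocApprox f)

/-- A neighbour farther away than `r` would force all of `T` to be neighbours as well, giving more
than `Ndef d` of them. -/
theorem LocApprox.dist_nbr_le {θ : Pt d} {S T : Finset (Pt d)} {r : ℝ} (hTS : T ⊆ S)
    (hT : Ndef d ≤ T.card) (hr : ∀ z ∈ T, dist z θ ≤ r) : ∀ y ∈ A.nbr θ S, dist y θ ≤ r := by
  classical
  intro y hy
  by_contra! hlt
  have hsub : insert y T ⊆ A.nbr θ S := by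
    refine Finset.insert_subset hy fun z hz => ?_
    by_contra hzn
    exact absurd ((A.nbr_nearest θ S y hy z (hTS hz) hzn).trans (hr z hz)) (not_le.2 hlt)
  have hyT : y ∉ T := fun h => absurd (hr y h) (not_le.2 hlt)
  have h1 := Finset.card_le_card hsub
  rw [Finset.card_insert_of_notMem hyT,
    A.nbr_card θ S (hT.trans (Finset.card_le_card hTS))] at h1
  omega

/-- The approximation is exact at sampled points, and the algorithm checks poisedness only
elsewhere; hence the hypotheses conditional on `θ ∉ S`. -/
theorem abs_nominal_sub_le {lam : ℝ} (hlam : 0 ≤ lam) {θ : Pt d} {S : Finset (Pt d)} {r w : ℝ}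
    (hw0 : 0 ≤ w) (hw : ∀ y ∈ S, dist y θ ≤ r → |f y - f θ| ≤ w)
    (hpo : θ ∉ S → IsLamPoised lam θ (A.nbr θ S))
    (hT : θ ∉ S → ∃ T ⊆ S, Ndef d ≤ T.card ∧ ∀ z ∈ T, dist z θ ≤ r) :
    |nominal A θ S - f θ| ≤ Ndef d * (w * lam) := by
  unfold nominal
  split_ifs with h
  · simp only [sub_self, abs_zero]; positivity
  · obtain ⟨T, hTS, hTc, hTr⟩ := hT h
    have := (hpo h).abs_evalAt_sub_le (A.poly_none θ S) (c := f θ) hw0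
      fun y hy => hw y (A.nbr_subset _ _ hy) (A.dist_nbr_le hTS hTc hTr y hy)
    rwa [A.nbr_card θ S (hTc.trans (Finset.card_le_card hTS))] at this

variable {β γ lam : ℝ} {x y : Pt d}

theorem refineAt_eq_some {u : I × I} {S : Finset (Pt d)} {θ : Pt d}
    (h : refineAt A β γ lam x y u S = some θ) : θ = x ∨ θ = y := by
  unfold refineAt at h
  split_ifs at h <;> simp_all

theorem refineAt_eq_none {u : I × I} {S : Finset (Pt d)}
    (h : refineAt A β γ lam x y u S = none) :
    (y ∉ S → IsLamPoised lam y (A.nbr y S)) ∧ (x ∉ S → IsLamPoised lam x (A.nbr x S)) := by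
  unfold refineAt at h
  split_ifs at h
  tauto

theorem refined_subset_succ (u : ℕ → I × I) (S : Finset (Pt d)) (k : ℕ) :
    refined A β γ lam x y u S k ⊆ refined A β γ lam x y u S (k + 1) := by
  classical
  conv_rhs => rw [refined]
  split
  · exact subset_rfl
  · exact Finset.subset_insert _ _

theorem refined_mono (u : ℕ → I × I) (S : Finset (Pt d)) :
    Monotone (refined A β γ lam x y u S) :=
  monotone_nat_of_le_succ (refined_subset_succ A u S)

theorem mem_refined_succ (u : ℕ → I × I) (S : Finset (Pt d)) (k : ℕ) {θ : Pt d}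
    (h : refineAt A β γ lam x y (u k) (refined A β γ lam x y u S k) = some θ) :
    θ ∈ refined A β γ lam x y u S (k + 1) := by
  classical
  rw [refined, h]
  exact Finset.mem_insert_self _ _

theorem refined_subset {Θ : Set (Pt d)} (hx : x ∈ Θ) (hy : y ∈ Θ) (u : ℕ → I × I)
    {S : Finset (Pt d)} (hS : ∀ s ∈ S, s ∈ Θ) (k : ℕ) :
    ∀ s ∈ refined A β γ lam x y u S k, s ∈ Θ := by
  classical
  induction k with
  | zero => exact hS
  | succ k ih =>
    rw [refined]
    split
    · exact ih
    · rename_i θ hθ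
      intro s hs
      rcases Finset.mem_insert.1 hs with rfl | hs
      · rcases refineAt_eq_some A hθ with rfl | rfl <;> assumption
      · exact ih s hs

variable {A}
variable {Θ : Set (Pt d)} {S S' : Finset (Pt d)} {u : Draws} {x' : Pt d}

theorem Step.subset (h : Step A Θ β γ lam x S y u x' S') : S ⊆ S' := by
  rcases h with ⟨-, -, rfl⟩ | ⟨-, k, -, -, rfl, -⟩
  · exact subset_rfl
  · exact refined_mono A u.1 S (Nat.zero_le k)

theorem Step.subset_param (h : Step A Θ β γ lam x S y u x' S') (hx : x ∈ Θ)
    (hS : ∀ s ∈ S, s ∈ Θ) : ∀ s ∈ S', s ∈ Θ := by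
  rcases h with ⟨-, -, rfl⟩ | ⟨hy, k, -, -, rfl, -⟩
  · exact hS
  · exact refined_subset A hx hy u.1 hS k

theorem Step.state_eq (h : Step A Θ β γ lam x S y u x' S') : x' = x ∨ (y ∈ Θ ∧ x' = y) := by
  rcases h with ⟨-, rfl, -⟩ | ⟨hy, k, -, -, -, rfl⟩
  · exact Or.inl rfl
  · split_ifs
    · exact Or.inr ⟨hy, rfl⟩
    · exact Or.inl rfl

/-- If the first pass refines, the loop cannot end there, and later passes only enlarge the set.
Looking at the first pass alone reduces refinement to an event in the fresh draws. -/
theorem Step.mem_of_refineAt_zero (h : Step A Θ β γ lam x S y u x' S') (hy : y ∈ Θ) {θ : Pt d}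
    (hθ : refineAt A β γ lam x y (u.1 0) S = some θ) : θ ∈ S' := by
  rcases h with ⟨hy', -, -⟩ | ⟨-, k, -, hk, rfl, -⟩
  · exact absurd hy hy'
  · have h1 : θ ∈ refined A β γ lam x y u.1 S 1 := mem_refined_succ A u.1 S 0 hθ
    rcases Nat.eq_zero_or_pos k with rfl | hk0
    · exact absurd (hk.symm.trans hθ) (by simp)
    · exact refined_mono A u.1 S hk0 h1

theorem Step.proposal_mem (h : Step A Θ β γ lam x S y u x' S') (hy : y ∈ Θ)
    (h1 : ((u.1 0).1 : ℝ) < β) (h2 : ((u.1 0).2 : ℝ) < 1 / 2) : y ∈ S' :=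
  h.mem_of_refineAt_zero hy (by unfold refineAt; rw [if_pos h1, if_pos h2])

theorem Step.current_mem (h : Step A Θ β γ lam x S y u x' S') (hy : y ∈ Θ)
    (h1 : ((u.1 0).1 : ℝ) < β) (h2 : ¬ ((u.1 0).2 : ℝ) < 1 / 2) : x ∈ S' :=
  h.mem_of_refineAt_zero hy (by unfold refineAt; rw [if_pos h1, if_neg h2])

/-- The acceptance decision of a step, with an error estimate for the acceptance probability. -/
theorem Step.accept (h : Step A Θ β γ lam x S y u x' S') (hy : y ∈ Θ) (hlam : 0 ≤ lam)
    {r w : ℝ} (hw0 : 0 ≤ w)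
    (hw : ∀ s ∈ S', ∀ θ ∈ ({x, y} : Set (Pt d)), dist s θ ≤ r → |f s - f θ| ≤ w)
    (hT : ∀ θ ∈ ({x, y} : Set (Pt d)),
      θ ∈ S ∨ ∃ T ⊆ S, Ndef d ≤ T.card ∧ ∀ z ∈ T, dist z θ ≤ r) :
    ∃ a : ℝ, |a - min 1 (Real.exp (f y) / Real.exp (f x))| ≤ 2 * (Ndef d * (w * lam)) ∧
      ((u.2 : ℝ) < a → x' = y) ∧ (a ≤ (u.2 : ℝ) → x' = x) := by
  have hsub := h.subset
  rcases h with ⟨hy', -, -⟩ | ⟨-, k, -, hk, hS', hx'⟩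
  · exact absurd hy hy'
  rw [← hS'] at hk
  obtain ⟨py, px⟩ := refineAt_eq_none A hk
  have hT' : ∀ θ ∈ ({x, y} : Set (Pt d)), θ ∉ S' →
      ∃ T ⊆ S', Ndef d ≤ T.card ∧ ∀ z ∈ T, dist z θ ≤ r := by
    intro θ hθ hn
    rcases hT θ hθ with hm | ⟨T, h1, h2⟩
    · exact absurd (hsub hm) hn
    · exact ⟨T, h1.trans hsub, h2⟩
  have ex := abs_nominal_sub_le A hlam hw0 (fun s hs => hw s hs x (by simp)) px (hT' x (by simp))
  have ey := abs_nominal_sub_le A hlam hw0 (fun s hs => hw s hs y (by simp)) py (hT' y (by simp))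
  refine ⟨min 1 (zeta A x y S'), ?_, fun hu => ?_, fun hu => ?_⟩
  · rw [zeta, ← Real.exp_sub, ← Real.exp_sub]
    refine (abs_min_one_exp_sub_le _ _).trans ?_
    rw [show nominal A y S' - nominal A x S' - (f y - f x)
      = (nominal A y S' - f y) - (nominal A x S' - f x) by ring]
    refine (abs_sub _ _).trans ?_
    linarith
  · rw [hx', if_pos hu]
  · rw [hx', if_neg (not_lt.2 hu)]

end Deterministic

/-! ### Total variation distance -/

section TotalVariation

variable {α : Type*} [MeasurableSpace α] (μ ν : Measure α) [IsProbabilityMeasure μ]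
  [IsProbabilityMeasure ν]

theorem abs_measureReal_sub_le_one (B : Set α) : |μ.real B - ν.real B| ≤ 1 := by
  rw [abs_le]
  constructor <;>
  linarith [measureReal_nonneg (μ := μ) (s := B), measureReal_nonneg (μ := ν) (s := B),
    measureReal_le_one (μ := μ) (s := B), measureReal_le_one (μ := ν) (s := B)]

theorem abs_measureReal_sub_le_tvDist {B : Set α} (hB : MeasurableSet B) :
    |μ.real B - ν.real B| ≤ tvDist μ ν :=
  le_ciSup (f := fun B : {B : Set α // MeasurableSet B} => |μ.real B - ν.real B|)
    ⟨1, by rintro _ ⟨B, rfl⟩; exact abs_measureReal_sub_le_one μ ν B⟩ ⟨B, hB⟩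

theorem tvDist_le {μ ν : Measure α} {c : ℝ}
    (h : ∀ B, MeasurableSet B → |μ.real B - ν.real B| ≤ c) : tvDist μ ν ≤ c :=
  haveI : Nonempty {B : Set α // MeasurableSet B} := ⟨⟨∅, .empty⟩⟩
  ciSup_le fun B => h B B.2

theorem tvDist_nonneg {μ ν : Measure α} : 0 ≤ tvDist μ ν :=
  Real.iSup_nonneg fun _ => abs_nonneg _

/-- Layer-cake formula: integrate the difference of the measures of the superlevel sets over levels
in `[0, c]`. The constant is the oscillation of `h`, which is what yields the contraction factor `1
- δ`. -/
theorem abs_integral_sub_le_tvDist {h : α → ℝ} (hm : Measurable h) {a c : ℝ} (hc : 0 ≤ c)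
    (hμ : ∀ᵐ x ∂μ, a ≤ h x ∧ h x ≤ a + c) (hν : ∀ᵐ x ∂ν, a ≤ h x ∧ h x ≤ a + c) :
    |∫ x, h x ∂μ - ∫ x, h x ∂ν| ≤ c * tvDist μ ν := by
  have key : ∀ (κ : Measure α) [IsProbabilityMeasure κ], (∀ᵐ x ∂κ, a ≤ h x ∧ h x ≤ a + c) →
      ∫ x, h x ∂κ = a + ∫ s in (0 : ℝ)..c, κ.real {x | s ≤ h x - a} := by
    intro κ _ hκ
    have hi : Integrable (fun x => h x - a) κ := by
      refine Integrable.of_bound (hm.sub_const a).aestronglyMeasurable c ?_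
      filter_upwards [hκ] with x hx
      rw [Real.norm_eq_abs, abs_of_nonneg (by linarith [hx.1])]
      linarith [hx.2]
    have h1 := hi.integral_eq_integral_Ioc_meas_le (M := c)
      (by filter_upwards [hκ] with x hx; simpa using hx.1)
      (by filter_upwards [hκ] with x hx; linarith [hx.2])
    rw [intervalIntegral.integral_of_le hc, ← h1]
    have h2 : ∫ x, h x ∂κ = ∫ x, ((h x - a) + a) ∂κ := by simp
    rw [h2, integral_add hi (integrable_const a)]
    simp [add_comm]
  have hii : ∀ (κ : Measure α) [IsProbabilityMeasure κ],
      IntervalIntegrable (fun s : ℝ => κ.real {x | s ≤ h x - a}) volume 0 c := by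
    intro κ _
    refine Antitone.intervalIntegrable fun s t hst => measureReal_mono fun x hx => ?_
    exact hst.trans hx
  rw [key μ hμ, key ν hν, add_sub_add_left_eq_sub, ← intervalIntegral.integral_sub (hii μ) (hii ν)]
  have := intervalIntegral.norm_integral_le_of_norm_le_const (a := (0 : ℝ)) (b := c)
    (f := fun s => μ.real {x | s ≤ h x - a} - ν.real {x | s ≤ h x - a}) (C := tvDist μ ν)
    fun s _ => abs_measureReal_sub_le_tvDist μ ν
      (measurableSet_le measurable_const (hm.sub_const a))
  rwa [sub_zero, abs_of_nonneg hc, mul_comm, Real.norm_eq_abs] at this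

end TotalVariation

/-! ### Doeblin contraction for reversible jump chains -/

section Doeblin

variable {α : Type*} [MeasurableSpace α]

/-- The probability of moving from `x` into `B` for the chain that jumps from `x` to `y` with
density `q x y` with respect to `ν`, and stays at `x` otherwise. -/
def jumpProb (ν : Measure α) (q : α → α → ℝ) (B : Set α) (x : α) : ℝ :=
  B.indicator 1 x + ∫ y, q x y * (B.indicator 1 y - B.indicator 1 x) ∂ν

omit [MeasurableSpace α] in
theorem abs_indicator_one_sub_le (B : Set α) (x y : α) :
    |B.indicator (1 : α → ℝ) y - B.indicator 1 x| ≤ 1 := by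
  by_cases hx : x ∈ B <;> by_cases hy : y ∈ B <;> simp [hx, hy]

variable {ν : Measure α} [IsFiniteMeasure ν] {q : α → α → ℝ} (hq : Measurable (Function.uncurry q))
  {Cq : ℝ} (hq0 : ∀ x y, 0 ≤ q x y) (hqC : ∀ x y, q x y ≤ Cq) {B : Set α} (hB : MeasurableSet B)

include hq hB in
theorem measurable_jumpProb : Measurable (jumpProb ν q B) := by
  have h1 : Measurable (B.indicator (1 : α → ℝ)) := measurable_one.indicator hB
  refine h1.add (StronglyMeasurable.integral_prod_right (f := fun x y =>
    q x y * (B.indicator 1 y - B.indicator 1 x)) ?_).measurable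
  exact (hq.mul ((h1.comp measurable_snd).sub (h1.comp measurable_fst))).stronglyMeasurable

include hq hq0 hqC in
theorem integrable_jumpDensity (x : α) : Integrable (q x) ν :=
  Integrable.of_bound (hq.comp measurable_prodMk_left).aestronglyMeasurable Cq
    (Eventually.of_forall fun y => by
      rw [Real.norm_eq_abs, abs_of_nonneg (hq0 x y)]; exact hqC x y)

include hq hq0 hqC hB in
-- The minorization on `B` gives the lower bound and the one on `Bᶜ` the upper bound. The two bounds
-- do not depend on `x` and differ by `1 - δ`.
theorem jumpProb_bounds {ρ : α → ℝ} (hρ : Integrable ρ ν) (hρ1 : ∫ y, ρ y ∂ν = 1)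
    {x : α} {δ : ℝ} (hδ : ∀ᵐ y ∂ν, δ * ρ y ≤ q x y) (hq1 : ∫ y, q x y ∂ν ≤ 1) :
    δ * ∫ y in B, ρ y ∂ν ≤ jumpProb ν q B x ∧
      jumpProb ν q B x ≤ δ * (∫ y in B, ρ y ∂ν) + (1 - δ) := by
  have hqi := integrable_jumpDensity (ν := ν) hq hq0 hqC x
  have hle : ∀ T : Set α, δ * ∫ y in T, ρ y ∂ν ≤ ∫ y in T, q x y ∂ν := by
    intro T
    rw [← integral_const_mul]
    exact integral_mono_ae (hρ.restrict.const_mul δ) hqi.restrict (ae_restrict_of_ae hδ)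
  have hsρ := integral_add_compl hB hρ
  have hsq := integral_add_compl hB hqi
  have hb := hle B
  have hbc := hle Bᶜ
  have hbc' : δ * ∫ y in Bᶜ, ρ y ∂ν = δ - δ * ∫ y in B, ρ y ∂ν := by
    rw [← mul_one_sub]; congr 1; linarith
  have hqB0 : 0 ≤ ∫ y in B, q x y ∂ν := integral_nonneg fun y => hq0 x y
  have hqBc0 : 0 ≤ ∫ y in Bᶜ, q x y ∂ν := integral_nonneg fun y => hq0 x y
  by_cases hx : x ∈ B
  · have : jumpProb ν q B x = 1 - ∫ y in Bᶜ, q x y ∂ν := by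
      rw [jumpProb, ← integral_indicator hB.compl, sub_eq_add_neg, ← integral_neg]
      simp only [Set.indicator_of_mem hx, Pi.one_apply]
      congr 2 with y
      by_cases hy : y ∈ B <;> simp [hy]
    rw [this]
    constructor <;> linarith
  · have : jumpProb ν q B x = ∫ y in B, q x y ∂ν := by
      rw [jumpProb, ← integral_indicator hB]
      simp only [Set.indicator_of_notMem hx, zero_add, sub_zero]
      congr 1 with y
      by_cases hy : y ∈ B <;> simp [hy]
    rw [this]
    constructor <;> linarith

include hq hq0 hqC hB in
/-- A density in detailed balance with `q` is stationary. -/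
theorem integral_mul_jumpProb {ρ : α → ℝ} (hρm : Measurable ρ) {Cρ : ℝ} (hρ0 : ∀ x, 0 ≤ ρ x)
    (hρC : ∀ x, ρ x ≤ Cρ) (hbal : ∀ x y, ρ x * q x y = ρ y * q y x) :
    ∫ x, ρ x * jumpProb ν q B x ∂ν = ∫ x in B, ρ x ∂ν := by
  have h1 : Measurable (B.indicator (1 : α → ℝ)) := measurable_one.indicator hB
  let F : α → α → ℝ := fun x y => ρ x * (q x y * (B.indicator 1 y - B.indicator 1 x))
  have hFm : Measurable (Function.uncurry F) :=
    (hρm.comp measurable_fst).mul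
      (hq.mul ((h1.comp measurable_snd).sub (h1.comp measurable_fst)))
  have hFi : Integrable (Function.uncurry F) (ν.prod ν) := by
    refine Integrable.of_bound hFm.aestronglyMeasurable (Cρ * (Cq * 1))
      (Eventually.of_forall fun z => ?_)
    have hCρ : 0 ≤ Cρ := (hρ0 z.1).trans (hρC z.1)
    have hCq : 0 ≤ Cq := (hq0 z.1 z.2).trans (hqC z.1 z.2)
    simp only [Function.uncurry, F, Real.norm_eq_abs, abs_mul, abs_of_nonneg (hρ0 _),
      abs_of_nonneg (hq0 _ _)]
    exact mul_le_mul (hρC _) (mul_le_mul (hqC _ _) (abs_indicator_one_sub_le _ _ _)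
      (abs_nonneg _) hCq) (mul_nonneg (hq0 _ _) (abs_nonneg _)) hCρ
  -- Detailed balance makes `F` antisymmetric, so by Fubini its double integral equals its own
  -- negative.
  have hanti : ∫ x, ∫ y, F x y ∂ν ∂ν = 0 := by
    have h := integral_integral_swap hFi
    have h2 : ∀ x y, F x y = -F y x := by
      intro x y
      simp only [F]
      rw [← mul_assoc, ← mul_assoc, hbal x y]
      ring
    have h3 : ∫ y, ∫ x, F x y ∂ν ∂ν = -∫ y, ∫ x, F y x ∂ν ∂ν := by
      rw [← integral_neg]
      congr 1 with y
      rw [← integral_neg]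
      congr 1 with x
      exact h2 x y
    linarith
  have hρi : Integrable ρ ν := Integrable.of_bound hρm.aestronglyMeasurable Cρ
    (Eventually.of_forall fun y => by
      rw [Real.norm_eq_abs, abs_of_nonneg (hρ0 y)]; exact hρC y)
  have e : ∀ x, ρ x * jumpProb ν q B x = B.indicator ρ x + ∫ y, F x y ∂ν := by
    intro x
    simp only [F]
    rw [jumpProb, mul_add, integral_const_mul]
    congr 1
    by_cases hx : x ∈ B <;> simp [hx]
  simp_rw [e]
  have hFi' : Integrable (fun x => ∫ y, F x y ∂ν) ν := hFi.integral_prod_left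
  rw [integral_add (hρi.indicator hB) hFi', hanti, add_zero,
    integral_indicator hB]

include hq hq0 hqC hB in
/-- Doeblin's contraction estimate for a reversible jump chain. -/
theorem abs_integral_jumpProb_sub_le {ρ : α → ℝ} (hρm : Measurable ρ) {Cρ : ℝ}
    (hρ0 : ∀ x, 0 ≤ ρ x) (hρC : ∀ x, ρ x ≤ Cρ) (hρ1 : ∫ y, ρ y ∂ν = 1)
    (hbal : ∀ x y, ρ x * q x y = ρ y * q y x)
    {Θ : Set α} (hνΘ : ∀ᵐ x ∂ν, x ∈ Θ) {δ : ℝ} (hδ : ∀ x ∈ Θ, ∀ y ∈ Θ, δ * ρ y ≤ q x y)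
    (hq1 : ∀ x ∈ Θ, ∫ y, q x y ∂ν ≤ 1) (hδ1 : δ ≤ 1)
    (μ : Measure α) [IsProbabilityMeasure μ] (hμ : ∀ᵐ x ∂μ, x ∈ Θ)
    [IsProbabilityMeasure (ν.withDensity fun x => ENNReal.ofReal (ρ x))] :
    |∫ x, jumpProb ν q B x ∂μ - (ν.withDensity fun x => ENNReal.ofReal (ρ x)).real B|
      ≤ (1 - δ) * tvDist μ (ν.withDensity fun x => ENNReal.ofReal (ρ x)) := by
  set π := ν.withDensity fun x => ENNReal.ofReal (ρ x) with hπ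
  have hρi : Integrable ρ ν := Integrable.of_bound hρm.aestronglyMeasurable Cρ
    (Eventually.of_forall fun y => by
      rw [Real.norm_eq_abs, abs_of_nonneg (hρ0 y)]; exact hρC y)
  have hbd : ∀ x ∈ Θ, δ * ∫ y in B, ρ y ∂ν ≤ jumpProb ν q B x ∧
      jumpProb ν q B x ≤ δ * (∫ y in B, ρ y ∂ν) + (1 - δ) := fun x hx =>
    jumpProb_bounds hq hq0 hqC hB hρi hρ1 (hνΘ.mono fun y hy => hδ x hx y hy) (hq1 x hx)
  have hπΘ : ∀ᵐ x ∂π, x ∈ Θ := (withDensity_absolutelyContinuous _ _).ae_le hνΘ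
  have hπB : ∫ x, jumpProb ν q B x ∂π = π.real B := by
    rw [hπ, integral_withDensity_eq_integral_toReal_smul (by fun_prop)
      (Eventually.of_forall fun _ => ENNReal.ofReal_lt_top)]
    simp_rw [ENNReal.toReal_ofReal (hρ0 _), smul_eq_mul]
    rw [integral_mul_jumpProb hq hq0 hqC hB hρm hρ0 hρC hbal, measureReal_def,
      withDensity_apply _ hB, integral_eq_lintegral_of_nonneg_ae
        (Eventually.of_forall fun x => hρ0 x) hρm.aestronglyMeasurable]
  -- By stationarity both terms are integrals of one function, whose values on `Θ` lie in an
  -- interval of length `1 - δ`.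
  rw [← hπB]
  exact abs_integral_sub_le_tvDist μ π (measurable_jumpProb hq hB) (by linarith)
    (hμ.mono hbd) (hπΘ.mono hbd)

end Doeblin

/-- Once `e t < δ * (ε / 2)`, compare with the affine map `a ↦ (1 - δ) * a + δ * (ε / 2)`, whose
fixed point is `ε / 2`. -/
theorem tendsto_zero_of_contraction {a e : ℕ → ℝ} {δ : ℝ} (ha0 : ∀ t, 0 ≤ a t)
    (hδ0 : 0 < δ) (hδ1 : δ ≤ 1) (he : Tendsto e atTop (𝓝 0))
    (h : ∀ t, a (t + 1) ≤ (1 - δ) * a t + e t) : Tendsto a atTop (𝓝 0) := by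
  rw [Metric.tendsto_atTop]
  intro ε hε
  obtain ⟨T, hT⟩ := eventually_atTop.1 (he.eventually_lt_const (u := δ * (ε / 2)) (by positivity))
  have hb : ∀ n, a (T + n) ≤ (1 - δ) ^ n * a T + ε / 2 := by
    intro n
    induction n with
    | zero => simp; linarith
    | succ n ih =>
      have h1 := h (T + n)
      have h2 := hT (T + n) (Nat.le_add_right _ _)
      have h3 := mul_le_mul_of_nonneg_left ih (sub_nonneg.2 hδ1)
      rw [← add_assoc, pow_succ]
      nlinarith
  have hp : Tendsto (fun n : ℕ => (1 - δ) ^ n * a T) atTop (𝓝 0) := by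
    simpa using (tendsto_pow_atTop_nhds_zero_of_lt_one (sub_nonneg.2 hδ1)
      (by linarith)).mul_const (a T)
  obtain ⟨n₀, hn₀⟩ := eventually_atTop.1 (hp.eventually_lt_const (half_pos hε))
  refine ⟨T + n₀, fun n hn => ?_⟩
  obtain ⟨k, rfl⟩ := Nat.exists_eq_add_of_le ((Nat.le_add_right T n₀).trans hn)
  rw [Real.dist_eq, sub_zero, abs_of_nonneg (ha0 _)]
  linarith [hb k, hn₀ k (by omega)]

/-! ### Finite nets for atomless measures -/

section Cover

variable {E : Type*} [MetricSpace E] [MeasurableSpace E] [BorelSpace E]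
  [HereditarilyLindelofSpace E]

omit [BorelSpace E] in
-- The support meets the ball in a set of positive measure, which is infinite because finite sets
-- are null. Choose `n` of its points and separate them by disjoint open sets.
theorem exists_disjoint_open_pos {ν : Measure E} [NullSingletonClass ν] {x : E}
    (hx : x ∈ ν.support) {r : ℝ} (hr : 0 < r) (n : ℕ) :
    ∃ (t : Finset E) (V : E → Set E), t.card = n ∧
      (∀ z ∈ t, IsOpen (V z) ∧ V z ⊆ Metric.ball x r ∧ 0 < ν (V z)) ∧
      (t : Set E).PairwiseDisjoint V := by
  have hpos : 0 < ν (Metric.ball x r) :=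
    (Measure.mem_support_iff_forall x).1 hx _ (Metric.ball_mem_nhds x hr)
  have hinf : (ν.support ∩ Metric.ball x r).Infinite := by
    intro hfin
    have h0 := hfin.measure_zero ν
    rw [Measure.measure_inter_eq_of_ae (t := ν.support) Measure.support_mem_ae] at h0
    exact hpos.ne' h0
  obtain ⟨t, ht, hcard⟩ := hinf.exists_subset_card_eq n
  obtain ⟨U, hU, hdisj⟩ := t.finite_toSet.t2_separation
  refine ⟨t, fun z => U z ∩ Metric.ball x r, hcard, fun z hz => ?_, ?_⟩
  · have ho : IsOpen (U z ∩ Metric.ball x r) := (hU z).2.inter Metric.isOpen_ball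
    exact ⟨ho, Set.inter_subset_right, (Measure.mem_support_iff_forall z).1 (ht hz).1 _
      (ho.mem_nhds ⟨(hU z).1, (ht hz).2⟩)⟩
  · exact fun a ha b hb hab => (hdisj ha hb hab).mono Set.inter_subset_left Set.inter_subset_left

/-- Finitely many sets of positive measure such that every set that meets all of them has at least
`n` points close to every point of the support. -/
theorem exists_finite_net {ν : Measure E} [NullSingletonClass ν] (hK : IsCompact ν.support)
    {r : ℝ} (hr : 0 < r) (n : ℕ) :
    ∃ 𝒱 : Set (Set E), 𝒱.Finite ∧ (∀ V ∈ 𝒱, MeasurableSet V ∧ 0 < ν V) ∧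
      ∀ D : Set E, (∀ V ∈ 𝒱, (D ∩ V).Nonempty) → ∀ θ ∈ ν.support,
        ∃ T : Finset E, (T : Set E) ⊆ D ∧ n ≤ T.card ∧ ∀ z ∈ T, dist z θ ≤ r := by
  classical
  have hloc : ∀ x : E, ∃ (t : Finset E) (V : E → Set E), x ∈ ν.support → t.card = n ∧
      (∀ z ∈ t, IsOpen (V z) ∧ V z ⊆ Metric.ball x (r / 2) ∧ 0 < ν (V z)) ∧
      (t : Set E).PairwiseDisjoint V := by
    intro x
    by_cases hx : x ∈ ν.support
    · obtain ⟨t, V, h⟩ := exists_disjoint_open_pos hx (half_pos hr) n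
      exact ⟨t, V, fun _ => h⟩
    · exact ⟨∅, fun _ => ∅, fun h => absurd h hx⟩
  choose t V htV using hloc
  obtain ⟨c, hcK, hcfin, hcover⟩ := hK.finite_cover_balls (half_pos hr)
  refine ⟨⋃ x ∈ c, V x '' (t x : Set E), ?_, ?_, ?_⟩
  · exact hcfin.biUnion fun x _ => (t x).finite_toSet.image _
  · intro W hW
    simp only [Set.mem_iUnion] at hW
    obtain ⟨x, hx, z, hz, rfl⟩ := hW
    obtain ⟨ho, -, hp⟩ := (htV x (hcK hx)).2.1 z hz
    exact ⟨ho.measurableSet, hp⟩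
  · intro D hD θ hθ
    obtain ⟨x, hx, hθx⟩ : ∃ x ∈ c, θ ∈ Metric.ball x (r / 2) := by
      simpa using hcover hθ
    obtain ⟨hcard, hV, hdisj⟩ := htV x (hcK hx)
    have hpt : ∀ z : E, ∃ y : E, z ∈ t x → y ∈ D ∩ V x z := by
      intro z
      by_cases hz : z ∈ t x
      · obtain ⟨y, hy⟩ := hD (V x z) (Set.mem_biUnion hx ⟨z, hz, rfl⟩)
        exact ⟨y, fun _ => hy⟩
      · exact ⟨z, fun h => absurd h hz⟩
    choose g hg using hpt
    refine ⟨(t x).image g, ?_, ?_, ?_⟩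
    · intro y hy
      obtain ⟨z, hz, rfl⟩ := Finset.mem_image.1 (Finset.mem_coe.1 hy)
      exact (hg z hz).1
    -- Representatives taken from disjoint sets are distinct, so there really are `n` points.
    · rw [Finset.card_image_of_injOn, hcard]
      intro a ha b hb hab
      by_contra hne
      refine Set.disjoint_left.1 (hdisj ha hb hne) (hg a ha).2 ?_
      have hab' : g a = g b := hab
      rw [hab']
      exact (hg b hb).2
    · intro y hy
      obtain ⟨z, hz, rfl⟩ := Finset.mem_image.1 hy
      have h1 := Metric.mem_ball.1 ((hV z hz).2.1 (hg z hz).2)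
      have h2 := Metric.mem_ball'.1 hθx
      linarith [dist_triangle (g z) x θ]

end Cover

/-! ### Law of the uniform draws -/

section Draws

instance : IsProbabilityMeasure drawLaw := by unfold drawLaw; infer_instance

theorem measurePreserving_drawLaw_snd :
    MeasurePreserving (Prod.snd : Draws → I) drawLaw volume :=
  measurePreserving_snd

theorem measurePreserving_drawLaw_first :
    MeasurePreserving (fun u : Draws => u.1 0) drawLaw
      ((volume : Measure I).prod (volume : Measure I)) :=
  (measurePreserving_eval_infinitePi
    (fun _ : ℕ => (volume : Measure I).prod (volume : Measure I)) 0).comp measurePreserving_fst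

theorem volume_unitInterval_lt_pos {b : ℝ} (hb0 : 0 < b) (hb1 : b ≤ 1) :
    0 < (volume : Measure I) {u | (u : ℝ) < b} := by
  have : {u : I | (u : ℝ) < b} = Set.Iio (⟨b, hb0.le, hb1⟩ : I) := rfl
  rw [this, unitInterval.volume_Iio]
  simpa using hb0

/-- The draws for which the first pass refines at the proposal. -/
def refineProposal (β : ℝ) : Set Draws :=
  (fun u : Draws => u.1 0) ⁻¹' ({u : I | (u : ℝ) < β} ×ˢ {u : I | (u : ℝ) < 1 / 2})

/-- The draws for which the first pass refines at the current point. -/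
def refineCurrent (β : ℝ) : Set Draws :=
  (fun u : Draws => u.1 0) ⁻¹' ({u : I | (u : ℝ) < β} ×ˢ {u : I | (u : ℝ) < 1 / 2}ᶜ)

theorem measurableSet_refineProposal (β : ℝ) : MeasurableSet (refineProposal β) :=
  measurePreserving_drawLaw_first.measurable
    ((measurableSet_lt measurable_subtype_coe measurable_const).prod
      (measurableSet_lt measurable_subtype_coe measurable_const))

theorem measurableSet_refineCurrent (β : ℝ) : MeasurableSet (refineCurrent β) :=
  measurePreserving_drawLaw_first.measurable
    ((measurableSet_lt measurable_subtype_coe measurable_const).prod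
      (measurableSet_lt measurable_subtype_coe measurable_const).compl)

theorem drawLaw_refineProposal_pos {β : ℝ} (hβ : 0 < β ∧ β < 1) :
    0 < drawLaw (refineProposal β) := by
  rw [refineProposal, measurePreserving_drawLaw_first.measure_preimage
    ((measurableSet_lt measurable_subtype_coe measurable_const).prod
      (measurableSet_lt measurable_subtype_coe measurable_const)).nullMeasurableSet,
    Measure.prod_prod]
  exact ENNReal.mul_pos (volume_unitInterval_lt_pos hβ.1 hβ.2.le).ne'
    (volume_unitInterval_lt_pos (by norm_num) (by norm_num)).ne'

theorem drawLaw_refineCurrent_pos {β : ℝ} (hβ : 0 < β ∧ β < 1) :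
    0 < drawLaw (refineCurrent β) := by
  rw [refineCurrent, measurePreserving_drawLaw_first.measure_preimage
    ((measurableSet_lt measurable_subtype_coe measurable_const).prod
      (measurableSet_lt measurable_subtype_coe measurable_const).compl).nullMeasurableSet,
    Measure.prod_prod]
  refine ENNReal.mul_pos (volume_unitInterval_lt_pos hβ.1 hβ.2.le).ne' ?_
  have : {u : I | (u : ℝ) < 1 / 2}ᶜ = Set.Ici (⟨1 / 2, by norm_num, by norm_num⟩ : I) := by
    ext u; simp [← Subtype.coe_le_coe]
  rw [this, unitInterval.volume_Ici]
  simp only [ne_eq, ENNReal.ofReal_eq_zero, not_le]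
  norm_num

theorem drawLaw_snd_lt {b : ℝ} (hb0 : 0 ≤ b) (hb1 : b ≤ 1) :
    drawLaw {u | (u.2 : ℝ) < b} = ENNReal.ofReal b := by
  have h := measurePreserving_drawLaw_snd.measure_preimage
    (s := Set.Iio (⟨b, hb0, hb1⟩ : I)) measurableSet_Iio.nullMeasurableSet
  rw [unitInterval.volume_Iio] at h
  exact h

theorem drawLaw_abs_snd_sub_le (b η : ℝ) :
    drawLaw {u | |(u.2 : ℝ) - b| ≤ η} ≤ ENNReal.ofReal (2 * η) := by
  have hm : MeasurableSet (Metric.closedBall b η) := measurableSet_closedBall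
  have h := (unitInterval.measurePreserving_coe.comp
    measurePreserving_drawLaw_snd).measure_preimage hm.nullMeasurableSet
  calc drawLaw {u | |(u.2 : ℝ) - b| ≤ η}
      = (volume.restrict I) (Metric.closedBall b η) := h
    _ ≤ volume (Metric.closedBall b η) := Measure.restrict_apply_le _ _
    _ = ENNReal.ofReal (2 * η) := Real.volume_closedBall b η

end Draws

/-! ### The exact Metropolis-Hastings step -/

section IdealStep

variable {d : ℕ} {L : Kernel (Pt d) (Pt d)} [IsMarkovKernel L]

open Classical in
/-- The new state of a Metropolis-Hastings step with acceptance probability `g`. -/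
def idealStep (g : Pt d → Pt d → ℝ) (z : (Pt d × Pt d) × Draws) : Pt d :=
  if (z.2.2 : ℝ) < g z.1.1 z.1.2 then z.1.2 else z.1.1

variable {g : Pt d → Pt d → ℝ} (hg : Measurable (Function.uncurry g))

include hg in
theorem measurable_accept_lt :
    MeasurableSet {z : (Pt d × Pt d) × Draws | (z.2.2 : ℝ) < g z.1.1 z.1.2} :=
  measurableSet_lt (measurable_subtype_coe.comp (measurable_snd.comp measurable_snd))
    (hg.comp measurable_fst)

include hg in
theorem measurable_idealStep : Measurable (idealStep g) :=
  Measurable.ite (measurable_accept_lt hg) (measurable_snd.comp measurable_fst)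
    (measurable_fst.comp measurable_fst)

include hg in
-- Integrate out the uniform draw first: given `(x, y)`, the move is accepted with probability
-- exactly `g x y`.
theorem integral_idealStep (hg0 : ∀ x y, 0 ≤ g x y) (hg1 : ∀ x y, g x y ≤ 1)
    (μ : Measure (Pt d)) [IsProbabilityMeasure μ] {B : Set (Pt d)} (hB : MeasurableSet B) :
    (((μ ⊗ₘ L).prod drawLaw).map (idealStep g)).real B
      = ∫ x, (B.indicator 1 x + ∫ y, g x y * (B.indicator 1 y - B.indicator 1 x) ∂(L x)) ∂μ := by
  have h1 : Measurable (B.indicator (1 : Pt d → ℝ)) := measurable_one.indicator hB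
  have hid : Integrable (fun z => B.indicator (1 : Pt d → ℝ) (idealStep g z))
      ((μ ⊗ₘ L).prod drawLaw) := by
    refine Integrable.of_bound (h1.comp (measurable_idealStep hg)).aestronglyMeasurable 1
      (Eventually.of_forall fun z => ?_)
    by_cases hz : idealStep g z ∈ B <;> simp [hz]
  have hin : ∀ x y, ∫ u, B.indicator (1 : Pt d → ℝ) (idealStep g ((x, y), u)) ∂drawLaw
      = B.indicator 1 x + g x y * (B.indicator 1 y - B.indicator 1 x) := by
    intro x y
    have hm : MeasurableSet {u : Draws | (u.2 : ℝ) < g x y} :=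
      measurableSet_lt (measurable_subtype_coe.comp measurable_snd) measurable_const
    have e : ∀ u : Draws, B.indicator (1 : Pt d → ℝ) (idealStep g ((x, y), u))
        = B.indicator 1 x + Set.indicator {u : Draws | (u.2 : ℝ) < g x y}
          (fun _ => B.indicator (1 : Pt d → ℝ) y - B.indicator 1 x) u := by
      intro u
      by_cases hu : (u.2 : ℝ) < g x y
      · simp [idealStep, hu]
      · simp [idealStep, hu]
    simp_rw [e]
    rw [integral_add (integrable_const _) ((integrable_const _).indicator hm),
      integral_indicator hm, setIntegral_const, measureReal_def,
      drawLaw_snd_lt (hg0 x y) (hg1 x y), ENNReal.toReal_ofReal (hg0 x y)]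
    simp
  have hgi : ∀ x, Integrable (fun y => g x y *
      (B.indicator (1 : Pt d → ℝ) y - B.indicator 1 x)) (L x) := by
    intro x
    refine Integrable.of_bound ((hg.comp measurable_prodMk_left).mul
      (h1.sub_const _)).aestronglyMeasurable 1 (Eventually.of_forall fun y => ?_)
    rw [Real.norm_eq_abs, abs_mul, abs_of_nonneg (hg0 x y)]
    exact mul_le_one₀ (hg1 x y) (abs_nonneg _) (abs_indicator_one_sub_le B x y)
  have hpi : Integrable (fun w : Pt d × Pt d => B.indicator (1 : Pt d → ℝ) w.1 + g w.1 w.2 *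
      (B.indicator 1 w.2 - B.indicator 1 w.1)) (μ ⊗ₘ L) := by
    have := hid.integral_prod_left
    refine this.congr (Eventually.of_forall fun w => ?_)
    exact hin w.1 w.2
  calc (((μ ⊗ₘ L).prod drawLaw).map (idealStep g)).real B
      = ∫ z, B.indicator (1 : Pt d → ℝ) z ∂(((μ ⊗ₘ L).prod drawLaw).map (idealStep g)) :=
        (integral_indicator_one hB).symm
    _ = ∫ z, B.indicator (1 : Pt d → ℝ) (idealStep g z) ∂((μ ⊗ₘ L).prod drawLaw) :=
        integral_map (measurable_idealStep hg).aemeasurable h1.aestronglyMeasurable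
    _ = ∫ w, (B.indicator (1 : Pt d → ℝ) w.1 + g w.1 w.2 *
          (B.indicator 1 w.2 - B.indicator 1 w.1)) ∂(μ ⊗ₘ L) := by
        rw [integral_prod _ hid]
        exact integral_congr_ae (Eventually.of_forall fun w => hin w.1 w.2)
    _ = _ := by
        rw [Measure.integral_compProd hpi]
        refine integral_congr_ae (Eventually.of_forall fun x => ?_)
        simp only
        rw [integral_add (integrable_const _) (hgi x)]
        simp

include hg in
theorem measure_abs_draw_sub_accept_le (μ : Measure (Pt d)) [IsProbabilityMeasure μ] (η : ℝ) :
    ((μ ⊗ₘ L).prod drawLaw) {z | |(z.2.2 : ℝ) - g z.1.1 z.1.2| ≤ η} ≤ ENNReal.ofReal (2 * η) := by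
  have hm : MeasurableSet {z : (Pt d × Pt d) × Draws | |(z.2.2 : ℝ) - g z.1.1 z.1.2| ≤ η} := by
    refine measurableSet_le (Measurable.abs ?_) measurable_const
    exact (measurable_subtype_coe.comp (measurable_snd.comp measurable_snd)).sub
      (hg.comp measurable_fst)
  rw [Measure.prod_apply hm]
  refine (lintegral_mono (g := fun _ => ENNReal.ofReal (2 * η)) fun w => ?_).trans (by simp)
  exact drawLaw_abs_snd_sub_le (g w.1 w.2) η

end IdealStep

/-! ### Sample paths -/

section Path

variable {d : ℕ} {f : Pt d → ℝ} {A : LocApprox f} {Θ : Set (Pt d)} {β lam : ℝ} {γ : ℕ → ℝ}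
  {x y : ℕ → Pt d} {S : ℕ → Finset (Pt d)} {u : ℕ → Draws}

theorem path_mem (h : ∀ t, Step A Θ β (γ t) lam (x t) (S t) (y t) (u t) (x (t + 1)) (S (t + 1)))
    (hx : x 0 ∈ Θ) (hS : ∀ s ∈ S 0, s ∈ Θ) (t : ℕ) : x t ∈ Θ ∧ ∀ s ∈ S t, s ∈ Θ := by
  induction t with
  | zero => exact ⟨hx, hS⟩
  | succ t ih =>
    refine ⟨?_, (h t).subset_param ih.1 ih.2⟩
    rcases (h t).state_eq with he | ⟨hy, he⟩
    · rw [he]; exact ih.1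
    · rw [he]; exact hy

theorem path_sample_mono
    (h : ∀ t, Step A Θ β (γ t) lam (x t) (S t) (y t) (u t) (x (t + 1)) (S (t + 1))) :
    Monotone S :=
  monotone_nat_of_le_succ fun t => (h t).subset

/-- If no proposal returns to the starting point, the chain is at a proposed point as soon as it
has left the starting point. -/
theorem path_start_or_mem {K : Set (Pt d)}
    (h : ∀ t, Step A Θ β (γ t) lam (x t) (S t) (y t) (u t) (x (t + 1)) (S (t + 1)))
    (hy : ∀ t, y t ∈ Θ → y t ∈ K ∧ y t ≠ x 0) (t : ℕ) : (∀ s ≤ t, x s = x 0) ∨ x t ∈ K := by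
  induction t with
  | zero => exact Or.inl fun s hs => by rw [Nat.le_zero.1 hs]
  | succ t ih =>
    rcases (h t).state_eq with he | ⟨hyΘ, he⟩
    · rw [he]
      rcases ih with ih | ih
      · refine Or.inl fun s hs => ?_
        rcases Nat.le_succ_iff.1 hs with hs | rfl
        · exact ih s hs
        · rw [he, ih t le_rfl]
      · exact Or.inr ih
    · rw [he]
      exact Or.inr (hy t hyΘ).1

end Path

/-! ### Joint laws and almost sure hitting -/

namespace IsChain

variable {d : ℕ} {f : Pt d → ℝ} {A : LocApprox f} {Ω : Type*} {mΩ : MeasurableSpace Ω}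
  {P : Measure Ω} [IsProbabilityMeasure P] {ℱ : Filtration ℕ mΩ} {Θ : Set (Pt d)}
  {L : Kernel (Pt d) (Pt d)} [IsMarkovKernel L] {β : ℝ} {γ : ℕ → ℝ} {lam : ℝ} {x₀ : Pt d}
  {S₀ : Finset (Pt d)} {X : ℕ → Ω → Pt d} {S : ℕ → Ω → Finset (Pt d)} {Y : ℕ → Ω → Pt d}
  {U : ℕ → Ω → Draws} (hX : IsChain A P ℱ Θ L β γ lam x₀ S₀ X S Y U)

include hX

omit [IsProbabilityMeasure P] [IsMarkovKernel L] in
theorem measurable_state (t : ℕ) : Measurable (X t) := (hX.measurable_X t).mono (ℱ.le t) le_rfl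

omit [IsProbabilityMeasure P] [IsMarkovKernel L] in
theorem measurable_proposal (t : ℕ) : Measurable (Y t) :=
  (hX.measurable_Y t).mono (ℱ.le (t + 1)) le_rfl

omit [IsProbabilityMeasure P] [IsMarkovKernel L] in
theorem measurable_draws (t : ℕ) : Measurable (U t) :=
  (hX.measurable_U t).mono (ℱ.le (t + 1)) le_rfl

omit [IsProbabilityMeasure P] [IsMarkovKernel L] in
theorem ae_state_mem (hx₀ : x₀ ∈ Θ) (hS₀ : ∀ s ∈ S₀, s ∈ Θ) :
    ∀ᵐ ω ∂P, ∀ t, X t ω ∈ Θ ∧ ∀ s ∈ S t ω, s ∈ Θ := by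
  filter_upwards [ae_all_iff.2 hX.step] with ω hω
  exact path_mem (x := fun t => X t ω) (S := fun t => S t ω) hω (by simpa [hX.start_X] using hx₀)
    (by simpa [hX.start_S] using hS₀)

/-- The adaptive state `X t` alone need not be Markov, but its marginal law determines its joint law
with the proposal and the draws. Apply `draw` with `F = X t ⁻¹' a`; measurable boxes determine the
law. -/
theorem map_joint (t : ℕ) :
    P.map (fun ω => ((X t ω, Y t ω), U t ω)) = ((P.map (X t)) ⊗ₘ L).prod drawLaw := by
  have hXm := hX.measurable_state t
  have hYm := hX.measurable_proposal t
  have hUm := hX.measurable_draws t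
  have := Measure.isProbabilityMeasure_map (μ := P) hXm.aemeasurable
  have := Measure.isProbabilityMeasure_map (μ := P) ((hXm.prodMk hYm).prodMk hUm).aemeasurable
  refine Measure.ext_prod₃' fun {a b c} ha hb hc => ?_
  rw [Measure.map_apply ((hXm.prodMk hYm).prodMk hUm) ((ha.prod hb).prod hc), Measure.prod_prod,
    Measure.compProd_apply_prod ha hb, setLIntegral_map ha (L.measurable_coe hb) hXm,
    ← hX.draw t (X t ⁻¹' a) (hX.measurable_X t ha) b hb c hc]
  congr 1
  ext ω
  simp [and_assoc]

omit [IsProbabilityMeasure P] [IsMarkovKernel L] in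
theorem ae_proposal_notMem (hΘ : ∀ᵐ ω ∂P, ∀ t, X t ω ∈ Θ) {N : Set (Pt d)} (hN : MeasurableSet N)
    (hN0 : ∀ x ∈ Θ, L x N = 0) : ∀ᵐ ω ∂P, ∀ t, Y t ω ∉ N := by
  rw [ae_all_iff]
  intro t
  have h := hX.draw t Set.univ .univ N hN Set.univ .univ
  simp only [Set.univ_inter, Set.preimage_univ, Set.inter_univ, measure_univ, mul_one,
    Measure.restrict_univ] at h
  rw [lintegral_congr_ae (g := fun _ => 0) (hΘ.mono fun ω hω => hN0 _ (hω t)),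
    lintegral_zero] at h
  exact measure_eq_zero_iff_ae_notMem.1 h

/-- A set that is proposed with probability bounded from below is hit almost surely, together with
any event of positive probability for the other draws. -/
theorem tendsto_measure_not_hit (hΘ : ∀ᵐ ω ∂P, ∀ t, X t ω ∈ Θ) {W : Set (Pt d)}
    (hW : MeasurableSet W) {c : ℝ≥0∞} (hc0 : c ≠ 0) (hc : ∀ x ∈ Θ, c ≤ L x W)
    {C : Set Draws} (hC : MeasurableSet C) (hC0 : drawLaw C ≠ 0) :
    Tendsto (fun t => P.real {ω | ∀ s < t, ¬ (Y s ω ∈ W ∧ U s ω ∈ C)}) atTop (𝓝 0) := by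
  set E : ℕ → Set Ω := fun t => {ω | ∀ s < t, ¬ (Y s ω ∈ W ∧ U s ω ∈ C)} with hE
  have hEm : ∀ t, MeasurableSet[ℱ t] (E t) := by
    intro t
    have : E t = ⋂ s ∈ Set.Iio t, (Y s ⁻¹' W ∩ U s ⁻¹' C)ᶜ := by
      ext ω; simp [hE]
    rw [this]
    refine MeasurableSet.biInter (Set.to_countable _) fun s hs => ?_
    exact (((hX.measurable_Y s hW).inter (hX.measurable_U s hC)).compl : _) |> ℱ.mono hs _
  have hEm' : ∀ t, MeasurableSet (E t) := fun t => ℱ.le t _ (hEm t)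
  have hx₀ : ∃ x, x ∈ Θ := by
    obtain ⟨ω, hω⟩ := hΘ.exists
    exact ⟨_, hω 0⟩
  obtain ⟨x, hx⟩ := hx₀
  have hc1 : c ≤ 1 := (hc x hx).trans prob_le_one
  have hcC : c * drawLaw C ≤ 1 := mul_le_one' hc1 prob_le_one
  have hcC' : c * drawLaw C ≠ ∞ := ne_top_of_le_ne_top ENNReal.one_ne_top hcC
  -- Given the past, each step hits with conditional probability at least `c * drawLaw C`, so the
  -- probability of no hit decays geometrically.
  refine tendsto_zero_of_contraction (e := fun _ => 0) (δ := (c * drawLaw C).toReal)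
    (fun t => measureReal_nonneg) (ENNReal.toReal_pos (mul_ne_zero hc0 hC0) hcC') ?_
    tendsto_const_nhds fun t => ?_
  · exact ENNReal.toReal_le_of_le_ofReal zero_le_one (by simpa using hcC)
  · have hsplit := measureReal_inter_add_sdiff (μ := P) (s := E t)
      ((hX.measurable_proposal t hW).inter (hX.measurable_draws t hC))
    have hsucc : E t \ (Y t ⁻¹' W ∩ U t ⁻¹' C) = E (t + 1) := by
      ext ω
      simp only [hE, Set.mem_sdiff, Set.mem_ofPred_eq, Set.mem_inter_iff, Set.mem_preimage,
        Nat.lt_succ_iff_lt_or_eq]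
      constructor
      · rintro ⟨h1, h2⟩ s (hs | rfl)
        · exact h1 s hs
        · exact h2
      · exact fun h => ⟨fun s hs => h s (Or.inl hs), h t (Or.inr rfl)⟩
    have hlow : (c * drawLaw C) * P (E t) ≤ P (E t ∩ (Y t ⁻¹' W ∩ U t ⁻¹' C)) := by
      rw [hX.draw t (E t) (hEm t) W hW C hC]
      have h1 : c * P (E t) ≤ ∫⁻ ω in E t, L (X t ω) W ∂P := by
        rw [← setLIntegral_const]
        exact lintegral_mono_ae (ae_restrict_of_ae (hΘ.mono fun ω hω => hc _ (hω t)))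
      calc c * drawLaw C * P (E t) = c * P (E t) * drawLaw C := by ring
        _ ≤ _ := by gcongr
    have hlow' := ENNReal.toReal_mono (measure_ne_top _ _) hlow
    rw [ENNReal.toReal_mul] at hlow'
    change P.real (E (t + 1)) ≤ _
    rw [hsucc] at hsplit
    simp only [measureReal_def] at hsplit ⊢
    linarith

end IsChain

/-- The Metropolis-Hastings acceptance probability for the density `p` on `Θ`. -/
def acceptProb {d : ℕ} (Θ : Set (Pt d)) (p : Pt d → ℝ) (x y : Pt d) : ℝ :=
  min 1 (Θ.indicator p y / Θ.indicator p x)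

/-! ### The exact acceptance probability -/

section Accept

variable {d : ℕ} {Θ : Set (Pt d)} {p : Pt d → ℝ}

theorem measurable_indicator_of_continuousOn (hΘ : IsCompact Θ) (hp : ContinuousOn p Θ) :
    Measurable (Θ.indicator p) := by
  classical
  rw [← Set.piecewise_eq_indicator]
  exact hp.measurable_piecewise continuousOn_const hΘ.measurableSet

theorem measurable_acceptProb (h : Measurable (Θ.indicator p)) :
    Measurable (Function.uncurry (acceptProb Θ p)) :=
  measurable_const.min ((h.comp measurable_snd).div (h.comp measurable_fst))

theorem acceptProb_le_one (x y : Pt d) : acceptProb Θ p x y ≤ 1 := min_le_left _ _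

theorem acceptProb_nonneg (h : ∀ x, 0 ≤ Θ.indicator p x) (x y : Pt d) :
    0 ≤ acceptProb Θ p x y :=
  le_min zero_le_one (div_nonneg (h y) (h x))

theorem acceptProb_of_notMem {x y : Pt d} (hy : y ∉ Θ) : acceptProb Θ p x y = 0 := by
  simp [acceptProb, hy]

theorem acceptProb_of_mem (hp : ∀ θ ∈ Θ, 0 < p θ) {x y : Pt d} (hx : x ∈ Θ) (hy : y ∈ Θ) :
    acceptProb Θ p x y = min 1 (Real.exp (Real.log (p y)) / Real.exp (Real.log (p x))) := by
  simp [acceptProb, hx, hy, Real.exp_log (hp x hx), Real.exp_log (hp y hy)]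

/-- The right-hand side is symmetric in `x` and `y`; this is the source of detailed balance. -/
theorem mul_acceptProb (hp : ∀ θ ∈ Θ, 0 < p θ) {x y : Pt d} (hx : x ∈ Θ) (hy : y ∈ Θ) :
    p x * acceptProb Θ p x y = min (p x) (p y) := by
  have h := hp x hx
  simp only [acceptProb, Set.indicator_of_mem hx, Set.indicator_of_mem hy]
  rw [mul_min_of_nonneg _ _ h.le, mul_one, mul_div_cancel₀ _ h.ne']

end Accept

/-! ### Vanishing discrepancy with the exact step -/

namespace IsChain

variable {d : ℕ} {p : Pt d → ℝ} {A : LocApprox fun θ => Real.log (p θ)} {Ω : Type*}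
  {mΩ : MeasurableSpace Ω} {P : Measure Ω} [IsProbabilityMeasure P] {ℱ : Filtration ℕ mΩ}
  {Θ : Set (Pt d)} {L : Kernel (Pt d) (Pt d)} [IsMarkovKernel L] {β : ℝ} {γ : ℕ → ℝ} {lam : ℝ}
  {x₀ : Pt d} {S₀ : Finset (Pt d)} {X : ℕ → Ω → Pt d} {S : ℕ → Ω → Finset (Pt d)}
  {Y : ℕ → Ω → Pt d} {U : ℕ → Ω → Draws}

/-- The chain asymptotically takes the same decisions as the exact Metropolis-Hastings chain. -/
theorem tendsto_measure_ne_idealStep [NullSingletonClass (volume : Measure (Pt d))]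
    (hX : IsChain A P ℱ Θ L β γ lam x₀ S₀ X S Y U) (hΘ : IsCompact Θ)
    (hp_cont : ContinuousOn p Θ) (hp_pos : ∀ θ ∈ Θ, 0 < p θ) (hvol : volume Θ ≠ 0)
    {m' : ℝ≥0∞} (hm' : m' ≠ 0) (hL_low : ∀ x ∈ Θ, ∀ W ⊆ Θ, MeasurableSet W → m' * volume W ≤ L x W)
    (hL_ac : ∀ x ∈ Θ, L x ≪ volume) (hβ : 0 < β ∧ β < 1) (hlam : 0 < lam) (hx₀ : x₀ ∈ Θ)
    (hS₀ : ∀ s ∈ S₀, s ∈ Θ) :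
    Tendsto (fun t => P.real {ω | X (t + 1) ω ≠
      idealStep (acceptProb Θ p) ((X t ω, Y t ω), U t ω)}) atTop (𝓝 0) := by
  have hg := measurable_acceptProb (measurable_indicator_of_continuousOn hΘ hp_cont)
  set g := acceptProb Θ p with hgdef
  set ν : Measure (Pt d) := volume.restrict Θ with hν
  have hKΘ : ν.support ⊆ Θ := by
    have := (Measure.support_restrict_subset (μ := volume) (s := Θ)).trans Set.inter_subset_left
    rwa [hΘ.isClosed.closure_eq] at this
  have hK : IsCompact ν.support := hΘ.of_isClosed_subset Measure.isClosed_support hKΘ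
  have hmem := hX.ae_state_mem hx₀ hS₀
  have hXΘ : ∀ᵐ ω ∂P, ∀ t, X t ω ∈ Θ := hmem.mono fun ω hω t => (hω t).1
  -- The part of `Θ` outside the support and the point `x₀` are Lebesgue null, so almost surely they
  -- are never proposed.
  have hYK : ∀ᵐ ω ∂P, ∀ t, Y t ω ∈ Θ → Y t ω ∈ ν.support ∧ Y t ω ≠ x₀ := by
    have hN : MeasurableSet ((ν.supportᶜ ∩ Θ) ∪ {x₀}) :=
      (Measure.isClosed_support.measurableSet.compl.inter hΘ.measurableSet).union
        (measurableSet_singleton _)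
    have h0 : volume ((ν.supportᶜ ∩ Θ) ∪ {x₀}) = 0 := by
      refine measure_union_null ?_ (measure_singleton _)
      rw [← Measure.restrict_apply Measure.isClosed_support.measurableSet.compl]
      exact Measure.measure_compl_support
    filter_upwards [hX.ae_proposal_notMem hXΘ hN fun x hx => hL_ac x hx h0] with ω hω t hy
    have := hω t
    simp only [Set.mem_union, Set.mem_inter_iff, Set.mem_compl_iff, Set.mem_singleton_iff,
      not_or, not_and] at this
    exact ⟨by by_contra h; exact this.1 h hy, this.2⟩
  rw [Metric.tendsto_atTop]
  intro ε hε
  have hN0 : (0 : ℝ) ≤ Ndef d := Nat.cast_nonneg _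
  -- Chosen so that `Ndef d * (w * lam) ≤ ε / 8`, whence the bad interval of draws, of length `2 *
  -- η`, costs at most `ε / 2`.
  set w : ℝ := ε / (8 * (Ndef d + 1) * lam) with hw
  have hw0 : 0 < w := by positivity
  set η : ℝ := 2 * (Ndef d * (w * lam)) with hη
  have hηε : 2 * η ≤ ε / 2 := by
    have : (Ndef d : ℝ) * (w * lam) ≤ ε / 8 := by
      have e : (Ndef d : ℝ) * (w * lam) = ε / 8 * (Ndef d / (Ndef d + 1)) := by
        rw [hw]; field_simp
      rw [e]
      exact mul_le_of_le_one_right (by positivity) (div_le_one_of_le₀ (by linarith) (by positivity))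
    linarith
  have hη0 : 0 ≤ η := by positivity
  have hlog : UniformContinuousOn (fun θ => Real.log (p θ)) Θ :=
    hΘ.uniformContinuousOn_of_continuous (hp_cont.log fun θ hθ => (hp_pos θ hθ).ne')
  obtain ⟨r, hr, hunif⟩ := Metric.uniformContinuousOn_iff_le.1 hlog w hw0
  obtain ⟨𝒱, h𝒱fin, h𝒱, hnet⟩ := exists_finite_net hK hr (Ndef d)
  -- These events involve only proposals and draws, so no measurability of the sample sets is
  -- needed.
  let noHit : Set (Pt d) → Set Draws → ℕ → Set Ω := fun W C t =>
    {ω | ∀ s < t, ¬ (Y s ω ∈ W ∧ U s ω ∈ C)}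
  have hlimV : ∀ V ∈ 𝒱, Tendsto (fun t => P.real (noHit (V ∩ Θ) (refineProposal β) t))
      atTop (𝓝 0) := by
    intro V hV
    have hVm := (h𝒱 V hV).1.inter hΘ.measurableSet
    refine hX.tendsto_measure_not_hit hXΘ hVm (c := m' * volume (V ∩ Θ)) (mul_ne_zero hm' ?_)
      (fun x hx => hL_low x hx _ Set.inter_subset_right hVm)
      (measurableSet_refineProposal β) (drawLaw_refineProposal_pos hβ).ne'
    have := (h𝒱 V hV).2
    rw [hν, Measure.restrict_apply (h𝒱 V hV).1] at this
    exact this.ne'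
  have hlimC : Tendsto (fun t => P.real (noHit Θ (refineCurrent β) t)) atTop (𝓝 0) :=
    hX.tendsto_measure_not_hit hXΘ hΘ.measurableSet (c := m' * volume Θ) (mul_ne_zero hm' hvol)
      (fun x hx => hL_low x hx _ subset_rfl hΘ.measurableSet)
      (measurableSet_refineCurrent β) (drawLaw_refineCurrent_pos hβ).ne'
  have hlim : Tendsto (fun t => (∑ V ∈ h𝒱fin.toFinset,
      P.real (noHit (V ∩ Θ) (refineProposal β) t)) + P.real (noHit Θ (refineCurrent β) t))
      atTop (𝓝 0) := by
    simpa using (tendsto_finsetSum h𝒱fin.toFinset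
      fun V hV => hlimV V (h𝒱fin.mem_toFinset.1 hV)).add hlimC
  obtain ⟨T, hT⟩ := eventually_atTop.1 (hlim.eventually_lt_const (half_pos hε))
  refine ⟨T, fun t ht => ?_⟩
  rw [Real.dist_eq, sub_zero, abs_of_nonneg measureReal_nonneg]
  let J : Set Ω := {ω | |((U t ω).2 : ℝ) - g (X t ω) (Y t ω)| ≤ η}
  have hJ : P.real J ≤ 2 * η := by
    have := Measure.isProbabilityMeasure_map (μ := P) (hX.measurable_state t).aemeasurable
    have h1 := measure_abs_draw_sub_accept_le (L := L) hg (P.map (X t)) η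
    rw [← hX.map_joint t] at h1
    have hm : Measurable fun ω => ((X t ω, Y t ω), U t ω) :=
      ((hX.measurable_state t).prodMk (hX.measurable_proposal t)).prodMk (hX.measurable_draws t)
    exact ENNReal.toReal_le_of_le_ofReal (by positivity)
      ((Measure.le_map_apply hm.aemeasurable _).trans h1)
  have hsub : ∀ᵐ ω ∂P, ω ∈ {ω | X (t + 1) ω ≠ idealStep g ((X t ω, Y t ω), U t ω)} →
      ω ∈ J ∪ ((⋃ V ∈ h𝒱fin.toFinset, noHit (V ∩ Θ) (refineProposal β) t) ∪
        noHit Θ (refineCurrent β) t) := by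
    filter_upwards [ae_all_iff.2 hX.step, hmem, hYK] with ω hstep hω hY hne
    by_contra hnot
    simp only [Set.mem_union, Set.mem_iUnion, not_or, not_exists, Set.Finite.mem_toFinset] at hnot
    obtain ⟨hnJ, hnV, hnC⟩ := hnot
    have hmono : Monotone fun t => S t ω := path_sample_mono (x := fun t => X t ω) hstep
    apply hne
    by_cases hy : Y t ω ∈ Θ
    swap
    · have h1 : X (t + 1) ω = X t ω := by
        rcases (hstep t).state_eq with h | ⟨h, -⟩
        · exact h
        · exact absurd h hy
      -- Outside `Θ` the exact acceptance probability is `0`, and a draw is never below `0`, so the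
      -- exact step rejects too.
      rw [h1, idealStep, if_neg]
      simp only [hgdef, acceptProb_of_notMem hy, not_lt]
      exact (U t ω).2.2.1
    have hnear : ∀ θ ∈ ν.support, ∃ T' ⊆ S t ω, Ndef d ≤ T'.card ∧ ∀ z ∈ T', dist z θ ≤ r := by
      refine hnet (S t ω : Set (Pt d)) fun V hV => ?_
      have := hnV V hV
      simp only [noHit, Set.mem_ofPred_eq, not_forall, not_not] at this
      obtain ⟨s, hs, hYs, hUs⟩ := this
      exact ⟨Y s ω, hmono (Nat.succ_le_of_lt hs) ((hstep s).proposal_mem hYs.2 hUs.1 hUs.2), hYs.1⟩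
    -- The starting point may lie outside the support, where the net gives nothing. While the chain
    -- still sits there, a forced refinement at the current point has made it a sample; afterwards
    -- the state is in the support.
    have hnearX : X t ω ∈ S t ω ∨
        ∃ T' ⊆ S t ω, Ndef d ≤ T'.card ∧ ∀ z ∈ T', dist z (X t ω) ≤ r := by
      rcases path_start_or_mem (x := fun t => X t ω) (K := ν.support) hstep
        (fun s hs => by simpa [hX.start_X] using hY s hs) t with h | h
      · left
        simp only [noHit, Set.mem_ofPred_eq, not_forall, not_not] at hnC
        obtain ⟨s, hs, hYs, hUs⟩ := hnC
        have h2 := hmono (Nat.succ_le_of_lt hs) ((hstep s).current_mem hYs hUs.1 hUs.2)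
        rw [show X t ω = X s ω from (h t le_rfl).trans (h s hs.le).symm]
        exact h2
      · exact Or.inr (hnear _ h)
    obtain ⟨a, ha, hacc, hrej⟩ := (hstep t).accept hy hlam.le (r := r) hw0.le
      (by
        rintro s hs θ hθ hd
        have hθΘ : θ ∈ Θ := by
          rcases hθ with rfl | rfl
          · exact (hω t).1
          · exact hy
        exact hunif s ((hω (t + 1)).2 s hs) θ hθΘ hd)
      (by
        rintro θ (rfl | rfl)
        · exact hnearX
        · exact Or.inr (hnear _ (hY t hy).1))
    rw [← acceptProb_of_mem hp_pos (hω t).1 hy, ← hgdef, ← hη] at ha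
    have hnJ' : ¬ |((U t ω).2 : ℝ) - g (X t ω) (Y t ω)| ≤ η := hnJ
    rw [abs_le] at ha hnJ'
    -- The draw is more than `η` away from the exact acceptance probability and the actual one is
    -- within `η` of it, so both thresholds give the same decision.
    rw [idealStep]
    split_ifs with hu
    · refine hacc ?_
      by_contra! h
      simp only at hu
      exact hnJ' ⟨by linarith, by linarith⟩
    · refine hrej ?_
      by_contra! h
      simp only at hu
      exact hnJ' ⟨by linarith, by linarith⟩
  calc P.real {ω | X (t + 1) ω ≠ idealStep g ((X t ω, Y t ω), U t ω)}
      ≤ P.real (J ∪ ((⋃ V ∈ h𝒱fin.toFinset, noHit (V ∩ Θ) (refineProposal β) t) ∪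
        noHit Θ (refineCurrent β) t)) :=
        ENNReal.toReal_mono (measure_ne_top _ _) (measure_mono_ae hsub)
    _ ≤ P.real J + ((∑ V ∈ h𝒱fin.toFinset, P.real (noHit (V ∩ Θ) (refineProposal β) t)) +
        P.real (noHit Θ (refineCurrent β) t)) := by
        refine (measureReal_union_le _ _).trans (add_le_add le_rfl ?_)
        refine (measureReal_union_le _ _).trans (add_le_add ?_ le_rfl)
        exact measureReal_biUnion_finset_le _ _
    _ < ε := by linarith [hT t ht]

end IsChain

theorem tvDist_eq_zero_of_subsingleton {α : Type*} [MeasurableSpace α] [Subsingleton α]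
    (μ ν : Measure α) [IsProbabilityMeasure μ] [IsProbabilityMeasure ν] : tvDist μ ν = 0 := by
  refine le_antisymm (tvDist_le fun B _ => ?_) tvDist_nonneg
  induction B using Subsingleton.set_cases <;> simp

/-- The coupling inequality: `Z` and `Z'` can disagree about `B` only where they differ. -/
theorem abs_map_real_sub_le {Ω α : Type*} [MeasurableSpace Ω] [MeasurableSpace α] {P : Measure Ω}
    [IsProbabilityMeasure P] {Z Z' : Ω → α} (hZ : Measurable Z) (hZ' : Measurable Z')
    {B : Set α} (hB : MeasurableSet B) :
    |(P.map Z).real B - (P.map Z').real B| ≤ P.real {ω | Z ω ≠ Z' ω} := by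
  have key : ∀ {Z Z' : Ω → α}, Measurable Z → Measurable Z' →
      (P.map Z).real B ≤ (P.map Z').real B + P.real {ω | Z ω ≠ Z' ω} := by
    intro Z Z' hZ hZ'
    rw [map_measureReal_apply hZ hB, map_measureReal_apply hZ' hB]
    refine (measureReal_mono (s₂ := Z' ⁻¹' B ∪ {ω | Z ω ≠ Z' ω}) fun ω hω => ?_).trans
      (measureReal_union_le _ _)
    by_cases h : Z ω = Z' ω
    · left
      change Z' ω ∈ B
      rw [← h]
      exact hω
    · exact Or.inr h
  have h1 := key hZ hZ'
  have h2 := key hZ' hZ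
  simp_rw [ne_comm (a := Z' _)] at h2
  rw [abs_le]
  constructor <;> linarith

section Target

variable {d : ℕ} {Θ : Set (Pt d)} {p : Pt d → ℝ}

theorem isProbabilityMeasure_targetMeasure (h : ∫⁻ θ in Θ, ENNReal.ofReal (p θ) = 1) :
    IsProbabilityMeasure (targetMeasure Θ p) :=
  ⟨by rw [targetMeasure, withDensity_apply _ .univ, Measure.restrict_univ, h]⟩

theorem targetMeasure_eq (hΘ : MeasurableSet Θ) :
    targetMeasure Θ p =
      (volume.restrict Θ).withDensity fun x => ENNReal.ofReal (Θ.indicator p x) := by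
  refine withDensity_congr_ae ?_
  filter_upwards [ae_restrict_mem hΘ] with x hx
  rw [Set.indicator_of_mem hx]

end Target

/-! ### Jump density and convergence -/

section Jump

variable {d : ℕ} {Θ : Set (Pt d)} {p : Pt d → ℝ} {l : Pt d → Pt d → ℝ}

/-- The density of the accepted moves of the Metropolis-Hastings chain. -/
def jumpDensity (Θ : Set (Pt d)) (p : Pt d → ℝ) (l : Pt d → Pt d → ℝ) (x y : Pt d) : ℝ :=
  (Θ ×ˢ Θ).indicator (Function.uncurry l) (x, y) * acceptProb Θ p x y

theorem jumpDensity_of_mem {x y : Pt d} (hx : x ∈ Θ) (hy : y ∈ Θ) :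
    jumpDensity Θ p l x y = l x y * acceptProb Θ p x y := by
  rw [jumpDensity, Set.indicator_of_mem (Set.mk_mem_prod hx hy), Function.uncurry]

theorem jumpDensity_of_notMem {x y : Pt d} (h : ¬ (x ∈ Θ ∧ y ∈ Θ)) :
    jumpDensity Θ p l x y = 0 := by
  rw [jumpDensity, Set.indicator_of_notMem (by simpa using h), zero_mul]

theorem measurable_jumpDensity (hΘ : MeasurableSet Θ) (hl : Measurable (Function.uncurry l))
    (hp : Measurable (Θ.indicator p)) : Measurable (Function.uncurry (jumpDensity Θ p l)) :=
  (hl.indicator (hΘ.prod hΘ)).mul (measurable_acceptProb hp)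

theorem jumpDensity_balance (hp : ∀ θ ∈ Θ, 0 < p θ) (hsymm : ∀ x ∈ Θ, ∀ y ∈ Θ, l x y = l y x)
    (x y : Pt d) :
    Θ.indicator p x * jumpDensity Θ p l x y = Θ.indicator p y * jumpDensity Θ p l y x := by
  by_cases h : x ∈ Θ ∧ y ∈ Θ
  · obtain ⟨hx, hy⟩ := h
    rw [jumpDensity_of_mem hx hy, jumpDensity_of_mem hy hx, Set.indicator_of_mem hx,
      Set.indicator_of_mem hy, mul_left_comm, mul_acceptProb hp hx hy, mul_left_comm,
      mul_acceptProb hp hy hx, min_comm, hsymm x hx y hy]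
  · rw [jumpDensity_of_notMem h, jumpDensity_of_notMem (fun h' => h h'.symm), mul_zero, mul_zero]

end Jump

theorem IsChain.tendsto_tvDist {d : ℕ}
    [NullSingletonClass (volume : Measure (Pt d))] {Θ : Set (Pt d)} (hΘ : IsCompact Θ)
    {p : Pt d → ℝ} (hp_cont : ContinuousOn p Θ)
    (hp_one : ∫⁻ θ in Θ, ENNReal.ofReal (p θ) = 1)
    (hp_bdd : ∃ m M : ℝ, 0 < m ∧ ∀ θ ∈ Θ, m ≤ p θ ∧ p θ ≤ M)
    {L : Kernel (Pt d) (Pt d)} [IsMarkovKernel L]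
    {l : Pt d → Pt d → ℝ} (hl_meas : Measurable (Function.uncurry l))
    (hl_dens : ∀ x ∈ Θ, L x = volume.withDensity fun y => ENNReal.ofReal (l x y))
    (hl_symm : ∀ x ∈ Θ, ∀ y ∈ Θ, l x y = l y x)
    (hl_bdd : ∃ m M : ℝ, 0 < m ∧ ∀ x ∈ Θ, ∀ y ∈ Θ, m ≤ l x y ∧ l x y ≤ M)
    {A : LocApprox fun θ => Real.log (p θ)}
    {β : ℝ} (hβ : 0 < β ∧ β < 1) {γ : ℕ → ℝ} {lam : ℝ} (hlam : 0 < lam)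
    {x₀ : Pt d} (hx₀ : x₀ ∈ Θ) {S₀ : Finset (Pt d)} (hS₀ : ∀ s ∈ S₀, s ∈ Θ)
    {Ω : Type*} {mΩ : MeasurableSpace Ω} {P : Measure Ω} [IsProbabilityMeasure P]
    {ℱ : Filtration ℕ mΩ} {X : ℕ → Ω → Pt d} {S : ℕ → Ω → Finset (Pt d)}
    {Y : ℕ → Ω → Pt d} {U : ℕ → Ω → Draws}
    (hX : IsChain A P ℱ Θ L β γ lam x₀ S₀ X S Y U) :
    Tendsto (fun t => tvDist (P.map (X t)) (targetMeasure Θ p)) atTop (𝓝 0) := by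
  obtain ⟨m, M, hm, hpb⟩ := hp_bdd
  obtain ⟨m', M', hm', hlb⟩ := hl_bdd
  have hp_pos : ∀ θ ∈ Θ, 0 < p θ := fun θ hθ => hm.trans_le (hpb θ hθ).1
  have hM : 0 < M := (hp_pos x₀ hx₀).trans_le (hpb x₀ hx₀).2
  have hM' : 0 < M' := hm'.trans_le ((hlb x₀ hx₀ x₀ hx₀).1.trans (hlb x₀ hx₀ x₀ hx₀).2)
  have hmM : m ≤ M := (hpb x₀ hx₀).1.trans (hpb x₀ hx₀).2
  have hΘm := hΘ.measurableSet
  have hvol : volume Θ ≠ 0 := by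
    intro h
    rw [Measure.restrict_eq_zero.2 h] at hp_one
    simp at hp_one
  have hfin : IsFiniteMeasure (volume.restrict Θ : Measure (Pt d)) :=
    isFiniteMeasure_restrict.2 hΘ.measure_lt_top.ne
  have hπ := isProbabilityMeasure_targetMeasure hp_one
  have hρm := measurable_indicator_of_continuousOn hΘ hp_cont
  have hρ0 : ∀ x, 0 ≤ Θ.indicator p x := fun x =>
    Set.indicator_nonneg (fun θ hθ => (hp_pos θ hθ).le) x
  have hρM : ∀ x, Θ.indicator p x ≤ M := by
    intro x
    by_cases hx : x ∈ Θ
    · rw [Set.indicator_of_mem hx]; exact (hpb x hx).2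
    · rw [Set.indicator_of_notMem hx]; exact hM.le
  have hqm := measurable_jumpDensity (l := l) hΘm hl_meas hρm
  have hg0 := acceptProb_nonneg hρ0
  have hq0 : ∀ x y, 0 ≤ jumpDensity Θ p l x y := by
    intro x y
    by_cases h : x ∈ Θ ∧ y ∈ Θ
    · rw [jumpDensity_of_mem h.1 h.2]
      exact mul_nonneg (hm'.le.trans (hlb x h.1 y h.2).1) (hg0 x y)
    · rw [jumpDensity_of_notMem h]
  have hqM : ∀ x y, jumpDensity Θ p l x y ≤ M' := by
    intro x y
    by_cases h : x ∈ Θ ∧ y ∈ Θ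
    · rw [jumpDensity_of_mem h.1 h.2]
      exact (mul_le_of_le_one_right (hm'.le.trans (hlb x h.1 y h.2).1)
        (acceptProb_le_one x y)).trans (hlb x h.1 y h.2).2
    · rw [jumpDensity_of_notMem h]; exact hM'.le
  have hρ1 : ∫ y, Θ.indicator p y ∂(volume.restrict Θ) = 1 := by
    rw [integral_eq_lintegral_of_nonneg_ae (Eventually.of_forall hρ0) hρm.aestronglyMeasurable,
      setLIntegral_congr_fun (g := fun θ => ENNReal.ofReal (p θ)) hΘm
        (fun θ hθ => by simp only [Set.indicator_of_mem hθ]), hp_one, ENNReal.toReal_one]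
  have hjump : ∀ x ∈ Θ, ∀ h : Pt d → ℝ, ∫ y, acceptProb Θ p x y * h y ∂(L x)
      = ∫ y, jumpDensity Θ p l x y * h y ∂(volume.restrict Θ) := by
    intro x hx h
    have hlx : Measurable (l x) := hl_meas.comp measurable_prodMk_left
    rw [hl_dens x hx, integral_withDensity_eq_integral_toReal_smul hlx.ennreal_ofReal
      (Eventually.of_forall fun _ => ENNReal.ofReal_lt_top),
      ← setIntegral_eq_integral_of_forall_compl_eq_zero (s := Θ)
        (fun y hy => by rw [acceptProb_of_notMem hy]; simp)]
    refine setIntegral_congr_fun hΘm fun y hy => ?_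
    rw [ENNReal.toReal_ofReal (hm'.le.trans (hlb x hx y hy).1), jumpDensity_of_mem hx hy,
      smul_eq_mul, mul_assoc]
  have hq1 : ∀ x ∈ Θ, ∫ y, jumpDensity Θ p l x y ∂(volume.restrict Θ) ≤ 1 := by
    intro x hx
    have h := hjump x hx 1
    simp only [Pi.one_apply, mul_one] at h
    rw [← h]
    have hle : ∫ y, acceptProb Θ p x y ∂(L x) ≤ ∫ _, (1 : ℝ) ∂(L x) :=
      integral_mono_of_nonneg (Eventually.of_forall fun y => hg0 x y) (integrable_const _)
        (Eventually.of_forall fun y => acceptProb_le_one x y)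
    simpa using hle
  -- On `Θ` the jump density is at least `m' * (m / M)`; dividing by `M` turns this into a multiple
  -- of the target density, which is at most `M`. The minimum with `1` ensures `δ ≤ 1`.
  set δ : ℝ := min 1 (m' * (m / M) / M) with hδ
  have hδ0 : 0 < δ := lt_min one_pos (by positivity)
  have hδ1 : δ ≤ 1 := min_le_left _ _
  have hδq : ∀ x ∈ Θ, ∀ y ∈ Θ, δ * Θ.indicator p y ≤ jumpDensity Θ p l x y := by
    intro x hx y hy
    have hacc : m / M ≤ acceptProb Θ p x y := by
      rw [acceptProb, Set.indicator_of_mem hx, Set.indicator_of_mem hy]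
      refine le_min (div_le_one_of_le₀ hmM hM.le) ?_
      exact div_le_div₀ (hp_pos y hy).le (hpb y hy).1 (hp_pos x hx) (hpb x hx).2
    rw [jumpDensity_of_mem hx hy]
    calc δ * Θ.indicator p y ≤ (m' * (m / M) / M) * M :=
          mul_le_mul (min_le_right _ _) (hρM y) (hρ0 y) (by positivity)
      _ = m' * (m / M) := by field_simp
      _ ≤ _ := mul_le_mul (hlb x hx y hy).1 hacc (by positivity) (hm'.le.trans (hlb x hx y hy).1)
  have hmem : ∀ᵐ ω ∂P, ∀ t, X t ω ∈ Θ := (hX.ae_state_mem hx₀ hS₀).mono fun ω hω t => (hω t).1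
  have hlow : ∀ x ∈ Θ, ∀ W ⊆ Θ, MeasurableSet W → ENNReal.ofReal m' * volume W ≤ L x W := by
    intro x hx W hWΘ hW
    rw [hl_dens x hx, withDensity_apply _ hW, ← setLIntegral_const]
    exact setLIntegral_mono' hW fun y hy => ENNReal.ofReal_le_ofReal (hlb x hx y (hWΘ hy)).1
  have hlim := hX.tendsto_measure_ne_idealStep hΘ hp_cont hp_pos hvol
    (ENNReal.ofReal_pos.2 hm').ne' hlow
    (fun x hx => by rw [hl_dens x hx]; exact withDensity_absolutelyContinuous _ _)
    hβ hlam hx₀ hS₀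
  -- The error term is the probability of leaving the exact step: `h1` bounds the coupling error and
  -- `h3` is the Doeblin contraction.
  refine tendsto_zero_of_contraction (fun t => tvDist_nonneg) hδ0 hδ1 hlim fun t => ?_
  have hgm := measurable_acceptProb hρm
  have hXm := hX.measurable_state t
  have hjm : Measurable fun ω => ((X t ω, Y t ω), U t ω) :=
    (hXm.prodMk (hX.measurable_proposal t)).prodMk (hX.measurable_draws t)
  have hμ := Measure.isProbabilityMeasure_map (μ := P) hXm.aemeasurable
  have hμΘ : ∀ᵐ x ∂(P.map (X t)), x ∈ Θ :=
    (ae_map_iff hXm.aemeasurable hΘm).2 (hmem.mono fun ω hω => hω t)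
  refine tvDist_le fun B hB => ?_
  have h1 := abs_map_real_sub_le (P := P) (hX.measurable_state (t + 1))
    ((measurable_idealStep hgm).comp hjm) hB
  have h2 : (P.map (idealStep (acceptProb Θ p) ∘ fun ω => ((X t ω, Y t ω), U t ω))).real B
      = ∫ x, jumpProb (volume.restrict Θ) (jumpDensity Θ p l) B x ∂(P.map (X t)) := by
    rw [← Measure.map_map (measurable_idealStep hgm) hjm, hX.map_joint t,
      integral_idealStep hgm hg0 acceptProb_le_one _ hB]
    refine integral_congr_ae (hμΘ.mono fun x hx => ?_)
    simp only
    rw [jumpProb, hjump x hx]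
  have h3 : |∫ x, jumpProb (volume.restrict Θ) (jumpDensity Θ p l) B x ∂(P.map (X t)) -
      (targetMeasure Θ p).real B| ≤ (1 - δ) * tvDist (P.map (X t)) (targetMeasure Θ p) := by
    rw [targetMeasure_eq hΘm] at hπ ⊢
    exact abs_integral_jumpProb_sub_le hqm hq0 hqM hB hρm hρ0 hρM hρ1
      (jumpDensity_balance hp_pos hl_symm) (ae_restrict_mem hΘm) hδq hq1 hδ1 _ hμΘ
  rw [h2] at h1
  refine (abs_sub_le _ _ _).trans ((add_le_add h1 h3).trans (le_of_eq ?_))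
  rw [add_comm]
  rfl

end LocalApproxMH

end

theorem mainTheorem2 {d : ℕ} (Θ : Set (LocalApproxMH.Pt d)) (hΘ : IsCompact Θ)
    -- the posterior density on `Θ`: continuous, bounded away from `0` and `∞`
    (p : LocalApproxMH.Pt d → ℝ) (hp_cont : ContinuousOn p Θ)
    (hp_one : ∫⁻ θ in Θ, ENNReal.ofReal (p θ) = 1)
    (hp_bdd : ∃ m M : ℝ, 0 < m ∧ ∀ θ ∈ Θ, m ≤ p θ ∧ p θ ≤ M)
    -- the proposal kernel and its density, symmetric and bounded away from `0` and `∞` on `Θ`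
    (L : ProbabilityTheory.Kernel (LocalApproxMH.Pt d) (LocalApproxMH.Pt d))
    [ProbabilityTheory.IsMarkovKernel L]
    (l : LocalApproxMH.Pt d → LocalApproxMH.Pt d → ℝ)
    (hl_meas : Measurable (Function.uncurry l))
    (hl_dens : ∀ x ∈ Θ, L x = MeasureTheory.volume.withDensity fun y => ENNReal.ofReal (l x y))
    (hl_symm : ∀ x ∈ Θ, ∀ y ∈ Θ, l x y = l y x)
    (hl_bdd : ∃ m M : ℝ, 0 < m ∧ ∀ x ∈ Θ, ∀ y ∈ Θ, m ≤ l x y ∧ l x y ≤ M)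
    -- the parameters of the algorithm
    (A : LocalApproxMH.LocApprox fun θ => Real.log (p θ))
    (β : ℝ) (hβ : 0 < β ∧ β < 1) (γ : ℕ → ℝ) (lam : ℝ) (hlam : 0 < lam)
    (x₀ : LocalApproxMH.Pt d) (hx₀ : x₀ ∈ Θ)
    (S₀ : Finset (LocalApproxMH.Pt d)) (hS₀ : ∀ s ∈ S₀, s ∈ Θ)
    (hS₀_card : LocalApproxMH.Ndef d ≤ S₀.card)
    -- a version of the chain
    {Ω : Type*} {mΩ : MeasurableSpace Ω} (P : MeasureTheory.Measure Ω)
    [MeasureTheory.IsProbabilityMeasure P] (ℱ : MeasureTheory.Filtration ℕ mΩ)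
    (X : ℕ → Ω → LocalApproxMH.Pt d) (S : ℕ → Ω → Finset (LocalApproxMH.Pt d))
    (Y : ℕ → Ω → LocalApproxMH.Pt d) (U : ℕ → Ω → LocalApproxMH.Draws)
    (hX : LocalApproxMH.IsChain A P ℱ Θ L β γ lam x₀ S₀ X S Y U) :
    Filter.Tendsto
      (fun t => LocalApproxMH.tvDist (P.map (X t)) (LocalApproxMH.targetMeasure Θ p))
      Filter.atTop (nhds 0) := by
  have hπ := LocalApproxMH.isProbabilityMeasure_targetMeasure hp_one
  cases d with
  -- In dimension `0` Lebesgue measure has an atom and the net argument fails, but on a one-point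
  -- space all probability measures agree.
  | zero =>
    have h : ∀ t, LocalApproxMH.tvDist (P.map (X t)) (LocalApproxMH.targetMeasure Θ p) = 0 := by
      intro t
      have := MeasureTheory.Measure.isProbabilityMeasure_map (μ := P)
        (hX.measurable_state t).aemeasurable
      exact LocalApproxMH.tvDist_eq_zero_of_subsingleton _ _
    simp [h]
  | succ k =>
    exact hX.tendsto_tvDist hΘ hp_cont hp_one hp_bdd hl_meas hl_dens hl_symm hl_bdd hβ hlam hx₀ hS₀
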